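/- **Structure theorem for a pair of projections, and its consequence for traces.** Let $\mathcal A_2$ be the universal unital C*-algebra generated by two projections $P_1,P_2$ and let $H$ be a complex Hilbert space. Write $S^1=\{z\in\mathbb C:|z|=1\}$ and $S_\pm=\{z\in S^1:\pm\operatorname{Im}z>0\}$. (a) The unital representations $\pi_0:\mathcal A_2\to B(H)$ correspond bijectively to the pairs $(\pi,V)$ consisting of a unital representation $\pi:C(S^1)\to B(H)$ and a symmetry $V$ (a unitary with $V^2=1$) with $V\pi(f)V^*=\pi(f\circ c)$, where $c(z)=\bar z$, for all $f\in C(S^1)$. The correspondence is determined by $V=2\widetilde P_1-1$ and $V\pi(z)=2\widetilde P_2-1$, where $\widetilde P_j=\pi_0(P_j)$ and $z$ is the coordinate function. (b) For every such representation there are closed subspaces $K_-,K_+$ of $H$, a set $I$, finite Borel measures $\mu_{+,i}$ on $S_+$ and $\mu_{-,i}$ on $S_-$ ($i\in I$), each $\mu_{+,i}$ being the image of $\mu_{-,i}$ under complex conjugation, and an orthogonal decomposition $$H= K_-\oplus K_+\oplus L^2(S_+,\mu_+)\oplus L^2(S_-,\mu_-),\qquad L^2(S_\pm,\mu_\pm):=\bigoplus_{i\in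 I}L^2(S_\pm,\mu_{\pm,i}),$$ with the following properties. 1. $\pi(f)=f(\pm1)I$ on $K_\pm$, and $\pi(f)$ is multiplication by $f$ on $L^2(S_\pm,\mu_\pm)$, for all $f\in C(S^1)$. 2. $V$ maps $K_\pm$ into themselves and switches $L^2(S_+,\mu_+)$ and $L^2(S_-,\mu_-)$ by $g\mapsto g(\bar{\,\cdot\,})$. 3. $\widetilde P_1,\widetilde P_2$ map $K_-\oplus K_+$ into itself and commute there. 4. On $L^2(S_+,\mu_+)\oplus L^2(S_-,\mu_-)$, $$\widetilde P_1=\tfrac12\begin{pmatrix}1&1\\1&1\end{pmatrix},\qquad \widetilde P_2=\tfrac12\begin{pmatrix}1&\pi(z)\\ \pi(z)&1\end{pmatrix},$$ where the off-diagonal entries are composed with the identification of $L^2(S_+,\mu_+)$ with $L^2(S_-,\mu_-)$ by $V$ (after multiplication by $z$); that is, for $w\in S_\pm$ and $h=(h_+,h_-)$, $$(\widetilde P_1h)_\pm(w)=\tfrac12\big(h_\pm(w)+h_\mp(\bar w)\big),\qquad (\widetilde P_2h)_\pm(w)=\tfrac12\big(h_\pm(w)+\bar w\,h_\mp(\bar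 w)\big).$$ 5. $\widetilde P_1-\widetilde P_2$ maps $L^2(S_\pm,\mu_\pm)$ into $L^2(S_\mp,\mu_\mp)$, and $K_-\oplus K_+$ is spanned by eigenvectors of $\widetilde P_1-\widetilde P_2$ in it with eigenvalues in $\{1,-1,0\}$. 6. If the restriction of $\pi$ to $(K_-\oplus K_+)^\perp$ has a cyclic vector, then $I$ can be taken to be a single point, so that $\mu_+$ and $\mu_-$ are single measures. (c) If $(\widetilde P_1-\widetilde P_2)^{2k+1}$ is trace class for some $k\ge0$, then for all $m\ge0$ the operator $(\widetilde P_1-\widetilde P_2)^{2k+1+2m}$ is trace class and $$\operatorname{tr}(\widetilde P_1-\widetilde P_2)^{2k+1+2m}=\operatorname{tr}(\widetilde P_1-\widetilde P_2)^{2k+1}.$$ -/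

import Mathlib

open MeasureTheory
open scoped ENNReal InnerProductSpace

universe u

noncomputable section

/-! ### The universal C*-algebra generated by `n` projections -/

/-- A (nonzero) unital C*-algebra together with `n` projections in it. -/
structure ProjTuple (n : ℕ) : Type (u + 1) where
  B : Type u
  [cstar : CStarAlgebra B]
  [nontriv : Nontrivial B]
  p : Fin n → B
  isProj : ∀ j, IsStarProjection (p j)

attribute [instance] ProjTuple.cstar ProjTuple.nontriv

/-- The C*-algebra of all bounded families `(b_t)`, one entry `b_t` for each `n`-tuple `t` of
projections in a C*-algebra. -/
abbrev ProjProd (n : ℕ) : Type (u + 1) := lp (fun t : ProjTuple.{u} n => t.B) ∞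

instance (n : ℕ) : CStarAlgebra (ProjProd.{u} n) where

/-- The `j`-th tautological family of projections. -/
def projProdGen (n : ℕ) (j : Fin n) : ProjProd.{u} n :=
  ⟨fun t => t.p j, memℓp_infty ⟨1, by
    rintro _ ⟨t, rfl⟩
    exact IsStarProjection.norm_le _ (t.isProj j)⟩⟩

/-- The universal unital C*-algebra generated by `n` projections: the completion of the free
unital *-algebra on `n` projections in the supremum of the seminorms coming from all `n`-tuples of
projections in C*-algebras, realised as the closed unital *-subalgebra that the tautological
families generate.  See `existsUnique_univProjAlg_hom` for its universal property. -/
def univProjSubalg (n : ℕ) : StarSubalgebra ℂ (ProjProd.{u} n) :=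
  (StarAlgebra.adjoin ℂ (Set.range (projProdGen.{u} n))).topologicalClosure

/-- The algebra `𝒜_n`. -/
abbrev UnivProjAlg (n : ℕ) : Type (u + 1) := univProjSubalg.{u} n

instance (n : ℕ) : IsClosed (univProjSubalg.{u} n : Set (ProjProd.{u} n)) :=
  StarSubalgebra.isClosed_topologicalClosure _

/-- The generators `P_1, …, P_n` of `𝒜_n` (indexed from `0`). -/
def univProj (n : ℕ) (j : Fin n) : UnivProjAlg.{u} n :=
  ⟨projProdGen n j, StarSubalgebra.le_topologicalClosure _
    (StarAlgebra.subset_adjoin ℂ _ ⟨j, rfl⟩)⟩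

theorem isStarProjection_univProj (n : ℕ) (j : Fin n) :
    IsStarProjection (univProj.{u} n j) := by
  constructor
  · apply Subtype.ext; apply lp.ext; funext t
    exact (t.isProj j).isIdempotentElem
  · apply Subtype.ext; apply lp.ext; funext t
    exact (t.isProj j).isSelfAdjoint

/-- Evaluation at one tuple of projections. -/
def univProjEval {n : ℕ} (t : ProjTuple.{u} n) : UnivProjAlg.{u} n →⋆ₐ[ℂ] t.B where
  toFun a := (a : ProjProd.{u} n) t
  map_one' := rfl
  map_mul' _ _ := rfl
  map_zero' := rfl
  map_add' _ _ := rfl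
  commutes' _ := rfl
  map_star' _ := rfl

/-- Continuous *-homomorphisms on a closed unital *-subalgebra agree if they do on generators. -/
theorem starAlgHom_ext_closure_adjoin {A B : Type*} [CStarAlgebra A] [CStarAlgebra B] {s : Set A}
    {φ ψ : (StarAlgebra.adjoin ℂ s).topologicalClosure →⋆ₐ[ℂ] B}
    (hφ : Continuous φ) (hψ : Continuous ψ)
    (h : ∀ (x : A) (hx : x ∈ s),
      φ ⟨x, StarSubalgebra.le_topologicalClosure _ (StarAlgebra.subset_adjoin ℂ s hx)⟩ =
        ψ ⟨x, StarSubalgebra.le_topologicalClosure _ (StarAlgebra.subset_adjoin ℂ s hx)⟩) :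
    φ = ψ := by
  refine StarAlgHom.ext_topologicalClosure hφ hψ ?_
  refine StarAlgHom.ext_adjoin (s := s) ?_
  intro x hx
  exact h x hx

/-- The universal property: `n` projections in a C*-algebra `B` are the images of the generators
under exactly one unital *-homomorphism `𝒜_n → B`. -/
theorem existsUnique_univProjAlg_hom {n : ℕ} {B : Type u} [CStarAlgebra B] (q : Fin n → B)
    (hq : ∀ j, IsStarProjection (q j)) :
    ∃! φ : UnivProjAlg.{u} n →⋆ₐ[ℂ] B, ∀ j, φ (univProj n j) = q j := by
  have hcont : ∀ φ : UnivProjAlg.{u} n →⋆ₐ[ℂ] B, Continuous φ := fun φ =>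
    AddMonoidHomClass.continuous_of_bound φ 1
      (by simpa only [one_mul] using! NonUnitalStarAlgHom.nnnorm_apply_le φ)
  refine existsUnique_of_exists_of_unique ?_ ?_
  · rcases subsingleton_or_nontrivial B with h | h
    · exact ⟨{ toFun := fun _ => 0
               map_one' := Subsingleton.elim _ _
               map_mul' := fun _ _ => Subsingleton.elim _ _
               map_zero' := rfl
               map_add' := fun _ _ => Subsingleton.elim _ _
               commutes' := fun _ => Subsingleton.elim _ _
               map_star' := fun _ => Subsingleton.elim _ _ }, fun _ => Subsingleton.elim _ _⟩
    · exact ⟨univProjEval ⟨B, q, hq⟩, fun _ => rfl⟩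
  · intro φ ψ hφ hψ
    refine starAlgHom_ext_closure_adjoin (hcont φ) (hcont ψ) ?_
    rintro _ ⟨j, rfl⟩
    exact (hφ j).trans (hψ j).symm

/-! ### Covariant representations of `(C(S¹), ℤ/2)` -/

/-- Complex conjugation on `S¹` (which is inversion there). -/
def circleConj : C(Circle, Circle) := ⟨fun z => z⁻¹, continuous_inv⟩

/-- The coordinate function `z` in `C(S¹)`. -/
def circleCoord : C(Circle, ℂ) := ⟨fun z => (z : ℂ), continuous_subtype_val⟩

/-- A (unital) representation `ρ` of `C(S¹)` on `H` together with a symmetry `V`, i.e. a unitary of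
square one, which implements the conjugation action of `ℤ/2` on `S¹`. -/
structure CovariantRep (H : Type u) [NormedAddCommGroup H] [InnerProductSpace ℂ H]
    [CompleteSpace H] where
  ρ : C(Circle, ℂ) →⋆ₐ[ℂ] (H →L[ℂ] H)
  V : H →L[ℂ] H
  unitary_V : V ∈ unitary (H →L[ℂ] H)
  sq_V : V * V = 1
  covariant : ∀ f : C(Circle, ℂ), V * ρ f * star V = ρ (f.comp circleConj)

/-! ### The model Hilbert space -/

/-- The open upper half `S₊` of the unit circle. -/
abbrev UpperArc : Type := {z : ℂ // ‖z‖ = 1 ∧ 0 < z.im}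

/-- The open lower half `S₋` of the unit circle. -/
abbrev LowerArc : Type := {z : ℂ // ‖z‖ = 1 ∧ z.im < 0}

/-- Conjugation `S₊ → S₋`. -/
def UpperArc.conj (z : UpperArc) : LowerArc :=
  ⟨(starRingEnd ℂ) z.1, by simpa using z.2.1, by simpa using z.2.2⟩

/-- Conjugation `S₋ → S₊`. -/
def LowerArc.conj (z : LowerArc) : UpperArc :=
  ⟨(starRingEnd ℂ) z.1, by simpa using z.2.1, by simpa using z.2.2⟩

/-- `S₊` as a subset of `S¹`. -/
def UpperArc.toCircle (z : UpperArc) : Circle := ⟨z.1, mem_sphere_zero_iff_norm.2 z.2.1⟩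

/-- `S₋` as a subset of `S¹`. -/
def LowerArc.toCircle (z : LowerArc) : Circle := ⟨z.1, mem_sphere_zero_iff_norm.2 z.2.1⟩

/-- The Hilbert space direct sum `⨁_i L²(X, μ_i)`. -/
abbrev L2Sum {X : Type} [MeasurableSpace X] {ι : Type u} (μ : ι → Measure X) : Type u :=
  lp (fun i => Lp ℂ 2 (μ i)) 2

/-- An orthogonal decomposition `H = K₋ ⊕ K₊ ⊕ L²(S₊, μ₊) ⊕ L²(S₋, μ₋)`, where `K₋`, `K₊` are closed
subspaces of `H` and the last two summands are embedded by a unitary `U`.  Multiplicities are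
allowed: `μ₊` and `μ₋` are families of finite measures, with `L²(S_±, μ_±) = ⨁_i L²(S_±, μ_{±,i})`,
and `μ_{+,i}` is the image of `μ_{-,i}` under conjugation. -/
structure HalmosDecomposition (H : Type u) [NormedAddCommGroup H] [InnerProductSpace ℂ H] where
  Kneg : Submodule ℂ H
  Kpos : Submodule ℂ H
  isClosed_Kneg : IsClosed (Kneg : Set H)
  isClosed_Kpos : IsClosed (Kpos : Set H)
  ι : Type u
  μpos : ι → Measure UpperArc
  μneg : ι → Measure LowerArc
  finite_pos : ∀ i, IsFiniteMeasure (μpos i)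
  finite_neg : ∀ i, IsFiniteMeasure (μneg i)
  μpos_eq : ∀ i, μpos i = (μneg i).map LowerArc.conj
  U : H ≃ₗᵢ[ℂ]
    WithLp 2 (WithLp 2 (Kneg × Kpos) × WithLp 2 (L2Sum μpos × L2Sum μneg))
  U_neg : ∀ x : Kneg, U x = WithLp.toLp 2 (WithLp.toLp 2 (x, 0), 0)
  U_pos : ∀ x : Kpos, U x = WithLp.toLp 2 (WithLp.toLp 2 (0, x), 0)

namespace HalmosDecomposition

variable {H : Type u} [NormedAddCommGroup H] [InnerProductSpace ℂ H]

/-- The `i`-th component in `L²(S₊, μ₊)` of a vector, as a function on `S₊`. -/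
def pos (D : HalmosDecomposition H) (x : H) (i : D.ι) : UpperArc → ℂ :=
  ((D.U x).snd.fst i : Lp ℂ 2 (D.μpos i))

/-- The `i`-th component in `L²(S₋, μ₋)` of a vector, as a function on `S₋`. -/
def neg (D : HalmosDecomposition H) (x : H) (i : D.ι) : LowerArc → ℂ :=
  ((D.U x).snd.snd i : Lp ℂ 2 (D.μneg i))

/-- The vector of `H` that corresponds to `f ∈ L²(S₊, μ₊)`. -/
def ofPos (D : HalmosDecomposition H) (f : L2Sum D.μpos) : H :=
  D.U.symm (WithLp.toLp 2 (0, WithLp.toLp 2 (f, 0)))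

/-- The vector of `H` that corresponds to `g ∈ L²(S₋, μ₋)`. -/
def ofNeg (D : HalmosDecomposition H) (g : L2Sum D.μneg) : H :=
  D.U.symm (WithLp.toLp 2 (0, WithLp.toLp 2 (0, g)))

/-- The subspace `K₋ ⊕ K₊`. -/
def K (D : HalmosDecomposition H) : Submodule ℂ H := D.Kneg ⊔ D.Kpos

end HalmosDecomposition

/-! ### Trace class operators -/

/-- `T` is trace class: `∑ ⟨e_i, |T| e_i⟩ < ∞` in some Hilbert basis `(e_i)`, `|T| = (T*T)^{1/2}`. -/
def IsTraceClass {H : Type u} [NormedAddCommGroup H] [InnerProductSpace ℂ H] [CompleteSpace H]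
    (T : H →L[ℂ] H) : Prop :=
  ∃ (ι : Type u) (b : HilbertBasis ι ℂ H), Summable fun i => (⟪b i, CFC.abs T (b i)⟫_ℂ).re

/-- `T` is trace class with trace `t`: in every Hilbert basis `(e_i)` the series `∑ ⟨e_i, T e_i⟩`
converges unconditionally to `t`. -/
def HasTrace {H : Type u} [NormedAddCommGroup H] [InnerProductSpace ℂ H] [CompleteSpace H]
    (T : H →L[ℂ] H) (t : ℂ) : Prop :=
  IsTraceClass T ∧ ∀ (ι : Type u) (b : HilbertBasis ι ℂ H), HasSum (fun i => ⟪b i, T (b i)⟫_ℂ) t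

end

/-!
Write `V = 2P₁ - 1` and `W = 2P₂ - 1` for the reflections of two projections.  The operator `VW` is
unitary, and conjugation by `V` turns it into `WV = (VW)*`.  By the continuous functional calculus
`VW` is the image of the coordinate function under a representation `ρ` of `C(S¹)`, and uniqueness
of such representations (Stone–Weierstrass) upgrades the relation for `VW` to covariance of `(ρ, V)`
on all of `C(S¹)`; conversely `(1 + V) / 2` and `(1 + Vρ(z)) / 2` are projections
(`exists_equiv_covariantRep`).

For the decomposition no Borel functional calculus is needed.  Let `p` and `n` be the positive and
negative parts of `Im z`.  The joint kernel of `ρ(p)` and `ρ(n)` is the sum of the spaces `K_±` on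
which `C(S¹)` acts by evaluation at `±1` (`eq_zero_of_orthogonal_charSpace`), and its complement is
the sum of `(ker ρ(p))ᗮ` and `(ker ρ(n))ᗮ`, which `V` interchanges because `n = p ∘ c`.  By Zorn's
lemma `(ker ρ(p))ᗮ` is a Hilbert sum of cyclic subspaces (`exists_generating_family`); if `w` is a
cyclic vector for `(K₋ ⊕ K₊)ᗮ`, then `ρ(p) w` alone generates it.  The cyclic subspace of a vector
`v` is `L²(μ)` for the Riesz–Markov–Kakutani measure `μ` of `f ↦ ⟨v, ρ(f) v⟩`
(`exists_cyclic_isometry`).  If `v ⟂ ker ρ(p)`, then `μ` lives on the open upper arc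
(`exists_isometry_of_mem_ker_orthogonal`).  Transporting these `L²` spaces by `V` gives the part
over the lower arc, and `CovariantRep.exists_halmosDecomposition` puts the summands together.  The
formulas for the projections follow from those for `V` and `ρ(z)`.

The statement on traces is independent of the decomposition.  With `A = P₁ - P₂` and
`B = 1 - P₁ - P₂` one has `AB = -BA` and `A² + B² = 1`.  A trace class power of `A` is a product of
two Hilbert–Schmidt operators, for which the trace is cyclic (`IsHilbertSchmidt.exists_trace`);
hence for odd `n` the trace of `A^n - A^(n+2) = A^n B² = -B A^n B` equals its own negative
(`hasTrace_sub_pow_of_isTraceClass`).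
-/

noncomputable section

/-! ### Hilbert–Schmidt operators and the trace -/

section Trace

variable {H : Type u} [NormedAddCommGroup H] [InnerProductSpace ℂ H]

/-- Parseval's identity. -/
theorem HilbertBasis.hasSum_norm_inner_sq {ι : Type*} (b : HilbertBasis ι ℂ H) (x : H) :
    HasSum (fun i => ‖⟪b i, x⟫_ℂ‖ ^ 2) (‖x‖ ^ 2) := by
  have h := b.hasSum_inner_mul_inner x x
  rw [inner_self_eq_norm_sq_to_K] at h
  have h2 := (Complex.hasSum_re h)
  convert h2 using 1
  · funext i
    rw [← inner_conj_symm x (b i), ← Complex.normSq_eq_conj_mul_self, Complex.ofReal_re,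
      Complex.normSq_eq_norm_sq]
  · norm_cast

/-- `T` is a Hilbert–Schmidt operator: `∑ ‖T e_i‖² < ∞` in some Hilbert basis `(e_i)`. -/
def IsHilbertSchmidt (T : H →L[ℂ] H) : Prop :=
  ∃ (ι : Type u) (b : HilbertBasis ι ℂ H), Summable fun i => ‖T (b i)‖ ^ 2

/-- The matrix of an operator with `∑ ‖T b_i‖² < ∞` is square summable. -/
theorem summable_norm_inner_sq {ι κ : Type*} (b : HilbertBasis ι ℂ H) (c : HilbertBasis κ ℂ H)
    {T : H →L[ℂ] H} (hT : Summable fun i => ‖T (b i)‖ ^ 2) :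
    Summable fun q : ι × κ => ‖⟪c q.2, T (b q.1)⟫_ℂ‖ ^ 2 := by
  rw [summable_prod_of_nonneg (fun _ => by positivity)]
  refine ⟨fun i => (c.hasSum_norm_inner_sq (T (b i))).summable, ?_⟩
  refine hT.congr fun i => ?_
  exact (c.hasSum_norm_inner_sq (T (b i))).tsum_eq.symm

theorem IsHilbertSchmidt.mul_left {T : H →L[ℂ] H} (hT : IsHilbertSchmidt T) (B : H →L[ℂ] H) :
    IsHilbertSchmidt (B * T) := by
  obtain ⟨ι, b, hb⟩ := hT
  refine ⟨ι, b, Summable.of_nonneg_of_le (fun _ => by positivity) (fun i => ?_)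
    (hb.mul_left (‖B‖ ^ 2))⟩
  rw [← mul_pow]
  exact pow_le_pow_left₀ (norm_nonneg _) (B.le_opNorm _) 2

variable [CompleteSpace H]

theorem summable_norm_star_sq {ι κ : Type*} (b : HilbertBasis ι ℂ H) (c : HilbertBasis κ ℂ H)
    {T : H →L[ℂ] H} (hT : Summable fun i => ‖T (b i)‖ ^ 2) :
    Summable fun j => ‖star T (c j)‖ ^ 2 := by
  have h := (summable_norm_inner_sq b c hT).prod_symm
  rw [summable_prod_of_nonneg (fun _ => by positivity)] at h
  refine h.2.congr fun j => ?_
  rw [← (b.hasSum_norm_inner_sq (star T (c j))).tsum_eq]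
  refine tsum_congr fun i => ?_
  rw [ContinuousLinearMap.star_eq_adjoint, ContinuousLinearMap.adjoint_inner_right]
  rw [← inner_conj_symm, RCLike.norm_conj]
  rfl

namespace IsHilbertSchmidt

theorem star {T : H →L[ℂ] H} (hT : IsHilbertSchmidt T) : IsHilbertSchmidt (star T) := by
  obtain ⟨ι, b, hb⟩ := hT
  exact ⟨ι, b, summable_norm_star_sq b b hb⟩

/-- The Hilbert–Schmidt condition does not depend on the basis. -/
theorem summable {T : H →L[ℂ] H} (hT : IsHilbertSchmidt T) {κ : Type*}
    (c : HilbertBasis κ ℂ H) : Summable fun i => ‖T (c i)‖ ^ 2 := by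
  obtain ⟨ι, b, hb⟩ := hT.star
  simpa using summable_norm_star_sq b c hb

theorem mul_right {T : H →L[ℂ] H} (hT : IsHilbertSchmidt T) (B : H →L[ℂ] H) :
    IsHilbertSchmidt (T * B) := by
  have h := (hT.star.mul_left (Star.star B)).star
  simpa using h

/-- For Hilbert–Schmidt operators `S`, `R`, the traces of `SR` and `RS` converge to the same value:
both are rearrangements of one absolutely convergent double series of matrix entries. -/
theorem exists_hasSum_mul {S R : H →L[ℂ] H} (hS : IsHilbertSchmidt S) (hR : IsHilbertSchmidt R)
    {ι κ : Type*} (b : HilbertBasis ι ℂ H) (c : HilbertBasis κ ℂ H) :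
    ∃ t : ℂ, HasSum (fun i => ⟪b i, (S * R) (b i)⟫_ℂ) t ∧
      HasSum (fun j => ⟪c j, (R * S) (c j)⟫_ℂ) t := by
  set F : ι × κ → ℂ := fun q => ⟪Star.star S (b q.1), c q.2⟫_ℂ * ⟪c q.2, R (b q.1)⟫_ℂ with hF
  have h1 := summable_norm_inner_sq b c (hS.star.summable b)
  have h2 := summable_norm_inner_sq b c (hR.summable b)
  have hFs : Summable F := by
    refine Summable.of_norm_bounded (h1.add h2) fun q => ?_
    rw [hF, norm_mul, ← inner_conj_symm, RCLike.norm_conj]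
    nlinarith [sq_nonneg (‖⟪c q.2, Star.star S (b q.1)⟫_ℂ‖ - ‖⟪c q.2, R (b q.1)⟫_ℂ‖),
      sq_nonneg (‖⟪c q.2, Star.star S (b q.1)⟫_ℂ‖), sq_nonneg (‖⟪c q.2, R (b q.1)⟫_ℂ‖)]
  refine ⟨∑' q, F q, ?_, ?_⟩
  · refine HasSum.prod_fiberwise hFs.hasSum fun i => ?_
    have := c.hasSum_inner_mul_inner (Star.star S (b i)) (R (b i))
    rwa [ContinuousLinearMap.star_eq_adjoint, ContinuousLinearMap.adjoint_inner_left] at this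
  · have hs : HasSum (F ∘ Prod.swap) (∑' q, F q) :=
      (Equiv.prodComm κ ι).hasSum_iff.2 hFs.hasSum
    refine HasSum.prod_fiberwise hs fun j => ?_
    have h := b.hasSum_inner_mul_inner (Star.star R (c j)) (S (c j))
    rw [ContinuousLinearMap.star_eq_adjoint, ContinuousLinearMap.adjoint_inner_left] at h
    refine (congrArg (HasSum · _) (funext fun i => ?_)).mpr h
    simp only [hF, Function.comp, Prod.swap, ContinuousLinearMap.star_eq_adjoint,
      ContinuousLinearMap.adjoint_inner_left]
    rw [mul_comm]

/-- The trace of a product of two Hilbert–Schmidt operators exists, does not depend on the basis,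
and does not change when the factors are exchanged. -/
theorem exists_trace {S R : H →L[ℂ] H} (hS : IsHilbertSchmidt S) (hR : IsHilbertSchmidt R) :
    ∃ t : ℂ, ∀ (ι : Type u) (b : HilbertBasis ι ℂ H),
      HasSum (fun i => ⟪b i, (S * R) (b i)⟫_ℂ) t ∧
      HasSum (fun i => ⟪b i, (R * S) (b i)⟫_ℂ) t := by
  obtain ⟨w, b₀, -⟩ := exists_hilbertBasis ℂ H
  obtain ⟨t, ht, -⟩ := hS.exists_hasSum_mul hR b₀ b₀
  have hRS : ∀ (ι : Type u) (b : HilbertBasis ι ℂ H),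
      HasSum (fun i => ⟪b i, (R * S) (b i)⟫_ℂ) t := by
    intro ι b
    obtain ⟨s, h1, h2⟩ := hS.exists_hasSum_mul hR b₀ b
    rwa [h1.unique ht] at h2
  refine ⟨t, fun ι b => ⟨?_, hRS ι b⟩⟩
  obtain ⟨s, h1, h2⟩ := hS.exists_hasSum_mul hR b b₀
  rwa [h2.unique (hRS _ b₀)] at h1

end IsHilbertSchmidt

/-- The absolute value of a power of a self-adjoint operator. -/
theorem abs_pow_eq_cfc {A : H →L[ℂ] H} (hA : IsSelfAdjoint A) (n : ℕ) :
    CFC.abs (A ^ n) = cfc (fun x : ℝ => |x ^ n|) A := by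
  rw [CFC.abs_eq_cfc_norm (A ^ n) (hA.pow n)]
  conv_lhs => rw [← cfc_pow_id (R := ℝ) A n hA]
  rw [← cfc_comp' (fun x : ℝ => ‖x‖) (fun x => x ^ n) A]
  rfl

/-- A trace class power `A ^ n` of a self-adjoint operator is a product `SR` of two Hilbert–Schmidt
operators, and higher powers of `A` are trace class too.  The factors come from the functional
calculus: `s(x) = √|xⁿ|`, and `r(x) = sgn(xⁿ) √|xⁿ|` written as a continuous function. -/
theorem exists_hilbertSchmidt_factorization {A : H →L[ℂ] H} (hA : IsSelfAdjoint A) {n : ℕ}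
    (hn : IsTraceClass (A ^ n)) :
    (∃ S R : H →L[ℂ] H, IsHilbertSchmidt S ∧ IsHilbertSchmidt R ∧ A ^ n = S * R) ∧
      ∀ m : ℕ, IsTraceClass (A ^ (n + m)) := by
  set s : ℝ → ℝ := fun x => √|x ^ n| with hs
  set r : ℝ → ℝ := fun x => √(x ^ n) - √(-x ^ n) with hr
  have hsc : Continuous s := by fun_prop
  have hrc : Continuous r := by fun_prop
  have hsr : ∀ x, s x * r x = x ^ n := by
    intro x
    simp only [hs, hr]
    rcases le_total 0 (x ^ n) with h | h
    · rw [abs_of_nonneg h, Real.sqrt_eq_zero_of_nonpos (by linarith : -x ^ n ≤ 0), sub_zero,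
        Real.mul_self_sqrt h]
    · rw [abs_of_nonpos h, Real.sqrt_eq_zero_of_nonpos h, zero_sub, mul_neg,
        Real.mul_self_sqrt (by linarith)]
      ring
  have hss : ∀ x, s x * s x = |x ^ n| := fun x => Real.mul_self_sqrt (abs_nonneg _)
  have hrr : ∀ x, r x * r x = |x ^ n| := by
    intro x
    simp only [hr]
    rcases le_total 0 (x ^ n) with h | h
    · rw [abs_of_nonneg h, Real.sqrt_eq_zero_of_nonpos (by linarith : -x ^ n ≤ 0), sub_zero,
        Real.mul_self_sqrt h]
    · rw [abs_of_nonpos h, Real.sqrt_eq_zero_of_nonpos h, zero_sub, neg_mul_neg,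
        Real.mul_self_sqrt (by linarith)]
  have key : ∀ f : ℝ → ℝ, Continuous f → (∀ x, f x * f x = |x ^ n|) → ∀ y,
      ‖cfc f A y‖ ^ 2 = (⟪y, CFC.abs (A ^ n) y⟫_ℂ).re := by
    intro f hf hff y
    have hmul : cfc f A * cfc f A = CFC.abs (A ^ n) := by
      rw [abs_pow_eq_cfc hA, ← cfc_mul f f A hf.continuousOn hf.continuousOn]
      simp only [hff]
    have hsa : IsSelfAdjoint (cfc f A) := cfc_predicate f A
    rw [← hmul, mul_apply_eq_comp, ← ContinuousLinearMap.adjoint_inner_left,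
      ← ContinuousLinearMap.star_eq_adjoint, hsa.star_eq, inner_self_eq_norm_sq_to_K]
    norm_cast
  have hS : IsHilbertSchmidt (cfc s A) := by
    obtain ⟨ι, b, hb⟩ := hn
    exact ⟨ι, b, hb.congr fun i => (key s hsc hss (b i)).symm⟩
  have hR : IsHilbertSchmidt (cfc r A) := by
    obtain ⟨ι, b, hb⟩ := hn
    exact ⟨ι, b, hb.congr fun i => (key r hrc hrr (b i)).symm⟩
  refine ⟨⟨_, _, hS, hR, ?_⟩, fun m => ?_⟩
  · rw [← cfc_mul s r A hsc.continuousOn hrc.continuousOn]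
    simp only [hsr]
    exact (cfc_pow_id (R := ℝ) A n hA).symm
  · -- `|A ^ (n + m)|` is the product of the Hilbert–Schmidt operators `√|A ^ n| |A ^ m|` and
    -- `√|A ^ n|`
    obtain ⟨w, b, -⟩ := exists_hilbertBasis ℂ H
    obtain ⟨t, ht⟩ := (hS.mul_right (cfc (fun x : ℝ => |x ^ m|) A)).exists_trace hS
    refine ⟨w, b, ?_⟩
    have h := (Complex.hasSum_re (ht w b).1).summable
    refine h.congr fun i => ?_
    have : CFC.abs (A ^ (n + m)) = cfc s A * cfc (fun x : ℝ => |x ^ m|) A * cfc s A := by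
      have hmc : Continuous fun x : ℝ => |x ^ m| := by fun_prop
      rw [abs_pow_eq_cfc hA, ← cfc_mul s _ A hsc.continuousOn hmc.continuousOn,
        ← cfc_mul (fun x => s x * |x ^ m|) s A (hsc.mul hmc).continuousOn hsc.continuousOn]
      congr 1
      funext x
      rw [pow_add, abs_mul, ← hss x]
      ring
    rw [this]

/-- For projections `P`, `Q` the operators `A = P - Q` and `B = 1 - P - Q` satisfy `AB + BA = 0` and
`A² + B² = 1`.  For odd `n` the operator `A^n B² = A^n - A^(n+2)` is therefore both the product
`(A^n B) B` and minus the product `B (A^n B)`, so its trace vanishes. -/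
theorem hasTrace_sub_pow_of_isTraceClass {P Q : H →L[ℂ] H} (hP : IsStarProjection P)
    (hQ : IsStarProjection Q) (k : ℕ) (hk : IsTraceClass ((P - Q) ^ (2 * k + 1))) :
    ∃ t : ℂ, ∀ m : ℕ, HasTrace ((P - Q) ^ (2 * k + 1 + 2 * m)) t := by
  have hA : IsSelfAdjoint (P - Q) := hP.isSelfAdjoint.sub hQ.isSelfAdjoint
  have hPP : P * P = P := hP.isIdempotentElem
  have hQQ : Q * Q = Q := hQ.isIdempotentElem
  have hAB : (1 - P - Q) * (P - Q) = -((P - Q) * (1 - P - Q)) := by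
    simp only [sub_mul, mul_sub, one_mul, mul_one, hPP, hQQ]; abel
  have hBB : (1 - P - Q) * (1 - P - Q) = 1 - (P - Q) * (P - Q) := by
    simp only [sub_mul, mul_sub, one_mul, mul_one, hPP, hQQ]; abel
  set A := P - Q
  set B := 1 - P - Q
  have hodd : ∀ k : ℕ, B * A ^ (2 * k + 1) = -(A ^ (2 * k + 1) * B) := by
    intro k
    induction k with
    | zero => simpa using hAB
    | succ k ih =>
      rw [show 2 * (k + 1) + 1 = (2 * k + 1) + 1 + 1 by ring, pow_succ, pow_succ, ← mul_assoc,
        ← mul_assoc, ih, neg_mul, neg_mul, mul_assoc _ B A, hAB, mul_neg, neg_mul, neg_neg,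
        mul_assoc (A ^ (2 * k + 1)), mul_assoc A B A, hAB]
      simp only [mul_neg, mul_assoc]
  have step : ∀ k : ℕ, IsTraceClass (A ^ (2 * k + 1)) → ∀ t, HasTrace (A ^ (2 * k + 1)) t →
      HasTrace (A ^ (2 * k + 1 + 2)) t := by
    intro k hk t ht
    obtain ⟨⟨S, R, hS, hR, hSR⟩, htc⟩ := exists_hilbertSchmidt_factorization hA hk
    refine ⟨htc 2, fun ι b => ?_⟩
    -- with `A ^ n = SR`, the trace of `S (RBB)` is that of `RBBS = (RB) (BS)`, hence that of
    -- `(BS) (RB) = B A ^ n B`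
    obtain ⟨a, ha⟩ := hS.exists_trace ((hR.mul_right B).mul_right B)
    obtain ⟨a', ha'⟩ := (hS.mul_left B).exists_trace (hR.mul_right B)
    have e1 : S * (R * B * B) = A ^ (2 * k + 1) * (B * B) := by
      rw [hSR]; simp only [mul_assoc]
    have e2 : R * B * (B * S) = R * B * B * S := by simp only [mul_assoc]
    have e3 : B * S * (R * B) = -(A ^ (2 * k + 1) * (B * B)) := by
      rw [← mul_assoc (A ^ (2 * k + 1)), ← neg_mul, ← hodd, hSR]; simp only [mul_assoc]
    have haa : a' = a := ((ha' ι b).2.unique (by rw [e2]; exact (ha ι b).2))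
    have h0 : a = 0 := by
      have h1 := (ha ι b).1
      have h2 := (ha' ι b).1
      rw [e1] at h1
      rw [e3, haa] at h2
      have h3 : HasSum (fun i => ⟪b i, (A ^ (2 * k + 1) * (B * B)) (b i)⟫_ℂ) (-a) := by
        simpa using h2.neg
      have h4 := h1.unique h3
      linear_combination (1 / 2 : ℂ) * h4
    have h1 := (ha ι b).1
    rw [h0, e1] at h1
    have h2 := (ht.2 ι b).sub h1
    rw [sub_zero] at h2
    refine (congrArg (HasSum · t) (funext fun i => ?_)).mpr h2
    rw [← inner_sub_right, ← sub_apply, hBB, pow_add]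
    congr 3
    rw [mul_sub, mul_one, sub_sub_cancel, pow_two]
  obtain ⟨⟨S, R, hS, hR, hSR⟩, -⟩ := exists_hilbertSchmidt_factorization hA hk
  obtain ⟨t, ht⟩ := hS.exists_trace hR
  refine ⟨t, fun m => ?_⟩
  induction m with
  | zero => exact ⟨hk, fun ι b => by simpa only [mul_zero, add_zero, hSR] using (ht ι b).1⟩
  | succ m ih =>
    have e : 2 * k + 1 + 2 * (m + 1) = 2 * (k + m) + 1 + 2 := by ring
    have e' : 2 * k + 1 + 2 * m = 2 * (k + m) + 1 := by ring
    rw [e]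
    rw [e'] at ih
    exact step _ ih.1 t ih

end Trace

/-! ### Cyclic representations of `C(X)` -/

section Cyclic

variable {X : Type*} [TopologicalSpace X] [CompactSpace X] [MeasurableSpace X]
  [BorelSpace X]

theorem norm_toLp_sq (μ : Measure X) [IsFiniteMeasure μ] (f : C(X, ℂ)) :
    ‖ContinuousMap.toLp (E := ℂ) 2 μ ℂ f‖ ^ 2 = ∫ x, ‖f x‖ ^ 2 ∂μ := by
  rw [@norm_sq_eq_re_inner ℂ, L2.inner_def, ← integral_re (L2.integrable_inner _ _)]
  refine integral_congr_ae ?_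
  filter_upwards [ContinuousMap.coeFn_toLp (p := 2) (𝕜 := ℂ) μ f] with x hx
  rw [hx, ← norm_sq_eq_re_inner]

/-- Multiplication by `f ∈ C(X)` on `L²(X, μ)`. -/
def mulL2 (μ : Measure X) [IsFiniteMeasure μ] (f : C(X, ℂ)) : Lp ℂ 2 μ →L[ℂ] Lp ℂ 2 μ :=
  (ContinuousLinearMap.mul ℂ ℂ).holderL μ ∞ 2 2 (ContinuousMap.toLp (E := ℂ) ∞ μ ℂ f)

theorem coeFn_mulL2 (μ : Measure X) [IsFiniteMeasure μ] (f : C(X, ℂ)) (g : Lp ℂ 2 μ) :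
    mulL2 μ f g =ᵐ[μ] fun x => f x * g x := by
  refine ((ContinuousLinearMap.mul ℂ ℂ).coeFn_holder (r := 2) _ g).trans ?_
  filter_upwards [ContinuousMap.coeFn_toLp (p := ∞) (𝕜 := ℂ) μ f] with x hx
  rw [hx]
  rfl

theorem mulL2_toLp (μ : Measure X) [IsFiniteMeasure μ] (f g : C(X, ℂ)) :
    mulL2 μ f (ContinuousMap.toLp (E := ℂ) 2 μ ℂ g) =
      ContinuousMap.toLp (E := ℂ) 2 μ ℂ (f * g) := by
  apply Lp.ext
  filter_upwards [coeFn_mulL2 μ f (ContinuousMap.toLp (E := ℂ) 2 μ ℂ g),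
    ContinuousMap.coeFn_toLp (p := 2) (𝕜 := ℂ) μ g,
    ContinuousMap.coeFn_toLp (p := 2) (𝕜 := ℂ) μ (f * g)] with x h1 h2 h3
  rw [h1, h2, h3]
  rfl

variable {H : Type*} [NormedAddCommGroup H] [InnerProductSpace ℂ H] [CompleteSpace H]

/-- The real-valued function `f`, as a complex-valued one. -/
def ofRealMap {X : Type*} [TopologicalSpace X] (f : C(X, ℝ)) : C(X, ℂ) :=
  ⟨fun x => (f x : ℂ), by fun_prop⟩

/-- A representation of `C(X)` is `*`-preserving, in terms of inner products. -/
theorem inner_rep_left {X : Type*} [TopologicalSpace X] (ρ : C(X, ℂ) →⋆ₐ[ℂ] (H →L[ℂ] H))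
    (f : C(X, ℂ)) (x y : H) : ⟪ρ f x, y⟫_ℂ = ⟪x, ρ (star f) y⟫_ℂ := by
  rw [map_star, ContinuousLinearMap.star_eq_adjoint, ContinuousLinearMap.adjoint_inner_right]

variable [T2Space X]

/-- The positive functional `f ↦ ⟨v, ρ(f) v⟩` is integration against a finite measure. -/
theorem exists_spectralMeasure (ρ : C(X, ℂ) →⋆ₐ[ℂ] (H →L[ℂ] H)) (v : H) :
    ∃ μ : Measure X, IsFiniteMeasure μ ∧ μ.Regular ∧
      ∀ f : C(X, ℂ), ∫ x, ‖f x‖ ^ 2 ∂μ = ‖ρ f v‖ ^ 2 := by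
  let Λ : CompactlySupportedContinuousMap X ℝ →ₗ[ℝ] ℝ :=
    { toFun := fun f => (⟪v, ρ (ofRealMap f.toContinuousMap) v⟫_ℂ).re
      map_add' := fun f g => by
        have : ofRealMap (f + g).toContinuousMap =
            ofRealMap f.toContinuousMap + ofRealMap g.toContinuousMap := by
          ext x; simp [ofRealMap]
        rw [this, map_add, add_apply, inner_add_right, Complex.add_re]
      map_smul' := fun c f => by
        have : ofRealMap (c • f).toContinuousMap = (c : ℂ) • ofRealMap f.toContinuousMap := by
          ext x; simp [ofRealMap]
        rw [this, map_smul, smul_apply, inner_smul_right,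
          Complex.re_ofReal_mul]
        rfl }
  have hsq : ∀ f : C(X, ℂ), (⟪v, ρ (star f * f) v⟫_ℂ).re = ‖ρ f v‖ ^ 2 := by
    intro f
    rw [map_mul, mul_apply_eq_comp, ← inner_rep_left, inner_self_eq_norm_sq_to_K]
    norm_cast
  have hpos : ∀ f, 0 ≤ f → 0 ≤ Λ f := by
    intro f hf
    let g : C(X, ℝ) := ⟨fun x => √(f x), by fun_prop⟩
    have : ofRealMap f.toContinuousMap = star (ofRealMap g) * ofRealMap g := by
      ext x
      simp only [ofRealMap, g, ContinuousMap.coe_mk, ContinuousMap.mul_apply,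
        ContinuousMap.star_apply, RCLike.star_def, Complex.conj_ofReal, ← Complex.ofReal_mul]
      congr 1
      exact (Real.mul_self_sqrt (hf x)).symm
    change 0 ≤ (⟪v, ρ (ofRealMap f.toContinuousMap) v⟫_ℂ).re
    rw [this, hsq]
    positivity
  let Λ' := PositiveLinearMap.mk₀ Λ hpos
  refine ⟨RealRMK.rieszMeasure Λ', inferInstance, inferInstance, fun f => ?_⟩
  let q : C(X, ℝ) := ⟨fun x => ‖f x‖ ^ 2, by fun_prop⟩
  have h := RealRMK.integral_rieszMeasure Λ'
    (CompactlySupportedContinuousMap.continuousMapEquiv q)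
  refine h.trans ?_
  rw [← hsq]
  change (⟪v, ρ (ofRealMap q) v⟫_ℂ).re = _
  congr 4
  ext x
  simp only [ofRealMap, q, ContinuousMap.coe_mk, ContinuousMap.mul_apply,
    ContinuousMap.star_apply, RCLike.star_def]
  rw [← Complex.normSq_eq_conj_mul_self, Complex.normSq_eq_norm_sq]

/-- The cyclic subrepresentation generated by `v` is multiplication on some `L²(X, μ)`, with `v`
corresponding to the constant function `1`. -/
theorem exists_cyclic_isometry [SecondCountableTopology X] (ρ : C(X, ℂ) →⋆ₐ[ℂ] (H →L[ℂ] H))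
    (v : H) :
    ∃ (μ : Measure X) (_ : IsFiniteMeasure μ) (J : Lp ℂ 2 μ →ₗᵢ[ℂ] H),
      DenseRange (ContinuousMap.toLp (E := ℂ) 2 μ ℂ) ∧
      (∀ f : C(X, ℂ), J (ContinuousMap.toLp (E := ℂ) 2 μ ℂ f) = ρ f v) ∧
      ∀ (f : C(X, ℂ)) (g : Lp ℂ 2 μ), J (mulL2 μ f g) = ρ f (J g) := by
  obtain ⟨μ, hμ, hreg, hint⟩ := exists_spectralMeasure ρ v
  let e : C(X, ℂ) →L[ℂ] Lp ℂ 2 μ := ContinuousMap.toLp (E := ℂ) 2 μ ℂ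
  have hd : DenseRange e := ContinuousMap.toLp_denseRange ℂ μ ℂ (by norm_num)
  let a : C(X, ℂ) →ₗ[ℂ] H :=
    { toFun := fun f => ρ f v
      map_add' := fun f g => by simp
      map_smul' := fun c f => by simp }
  have hnorm : ∀ f, ‖a f‖ = ‖e f‖ := by
    intro f
    refine (pow_left_inj₀ (norm_nonneg _) (norm_nonneg _) two_ne_zero).1 ?_
    rw [norm_toLp_sq, hint]
    rfl
  have hb : ∃ C, ∀ f, ‖a f‖ ≤ C * ‖e f‖ := ⟨1, fun f => by rw [one_mul, hnorm f]⟩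
  let J₀ := a.extendOfNorm e.toLinearMap
  have hJ₀ : ∀ f, J₀ (e f) = ρ f v := fun f => LinearMap.extendOfNorm_eq hd hb f
  let J : Lp ℂ 2 μ →ₗᵢ[ℂ] H :=
    { toLinearMap := J₀.toLinearMap
      norm_map' := by
        intro x
        refine hd.induction_on x (isClosed_eq (by
          change Continuous fun x => ‖J₀ x‖
          fun_prop) continuous_norm) fun f => ?_
        change ‖J₀ (e f)‖ = _
        rw [hJ₀, ← hnorm f]
        rfl }
  refine ⟨μ, hμ, J, hd, hJ₀, fun f g => ?_⟩
  refine hd.induction_on g (isClosed_eq (J.continuous.comp (mulL2 μ f).continuous)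
    ((ρ f).continuous.comp J.continuous)) fun k => ?_
  rw [mulL2_toLp]
  refine (hJ₀ _).trans ?_
  refine Eq.trans ?_ (congrArg (ρ f) (hJ₀ k)).symm
  simp

end Cyclic

/-! ### Restriction of a cyclic representation to an open set -/

section Restrict

variable {X : Type*} [TopologicalSpace X] [CompactSpace X] [T2Space X] [MeasurableSpace X]
  [BorelSpace X] [SecondCountableTopology X]
  {H : Type*} [NormedAddCommGroup H] [InnerProductSpace ℂ H] [CompleteSpace H]

/-- If `v ⟂ ker ρ(p)`, then the cyclic subrepresentation generated by `v` lives on the open set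
`{p ≠ 0}`: the vector that corresponds to the indicator function of `{p = 0}` is killed by `ρ(p)`,
hence orthogonal to `v`, which says that `{p = 0}` is a null set. -/
theorem exists_isometry_of_mem_ker_orthogonal {Y : Type*} [MeasurableSpace Y] {e : Y → X}
    (he : MeasurableEmbedding e) (ρ : C(X, ℂ) →⋆ₐ[ℂ] (H →L[ℂ] H)) {p : C(X, ℂ)}
    (hpe : ∀ x, p x ≠ 0 → x ∈ Set.range e) {v : H} (hv : v ∈ (LinearMap.ker (ρ p).toLinearMap)ᗮ) :
    ∃ (ν : Measure Y) (_ : IsFiniteMeasure ν) (J : Lp ℂ 2 ν →ₗᵢ[ℂ] H),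
      (∀ f : C(X, ℂ), ∃ g, J g = ρ f v) ∧
      (∀ x, (∀ f : C(X, ℂ), ⟪ρ f v, x⟫_ℂ = 0) → ∀ g, ⟪J g, x⟫_ℂ = 0) ∧
      ∀ (f : C(X, ℂ)) (g : Lp ℂ 2 ν), ∃ g' : Lp ℂ 2 ν,
        J g' = ρ f (J g) ∧ g' =ᵐ[ν] fun y => f (e y) * g y := by
  obtain ⟨μ, hμ, J, hd, hJ, hmul⟩ := exists_cyclic_isometry ρ v
  have hs : MeasurableSet {x | p x = 0} := (isClosed_eq p.continuous continuous_const).measurableSet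
  have hnull : μ {x | p x = 0} = 0 := by
    set w : Lp ℂ 2 μ := indicatorConstLp 2 hs (measure_ne_top μ _) (1 : ℂ) with hw
    have hker : mulL2 μ p w = 0 := by
      apply Lp.ext
      filter_upwards [coeFn_mulL2 μ p w, Lp.coeFn_zero ℂ 2 μ,
        indicatorConstLp_coeFn (p := 2) (hs := hs) (hμs := measure_ne_top μ _) (c := (1 : ℂ))]
        with x h1 h2 h3
      rw [h1, h2, hw, h3]
      by_cases hx : x ∈ {x | p x = 0}
      · simp [show p x = 0 from hx]
      · simp [hx]
    have hmem : J w ∈ LinearMap.ker (ρ p).toLinearMap := by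
      change ρ p (J w) = 0
      rw [← hmul, hker, map_zero]
    have h0 := (Submodule.mem_orthogonal _ _).1 hv _ hmem
    have hv1 : v = J (ContinuousMap.toLp (E := ℂ) 2 μ ℂ 1) := by rw [hJ, map_one]; rfl
    rw [hv1, J.inner_map_map, L2.inner_indicatorConstLp_one,
      setIntegral_congr_ae (g := fun _ => (1 : ℂ)) hs] at h0
    · simpa [measureReal_def, ENNReal.toReal_eq_zero_iff] using h0
    · filter_upwards [ContinuousMap.coeFn_toLp (p := 2) (𝕜 := ℂ) μ (1 : C(X, ℂ))] with x hx _
      rw [hx]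
      rfl
  have hmap : (μ.comap e).map e = μ := by
    rw [he.map_comap, Measure.restrict_eq_self_of_ae_mem]
    rw [ae_iff]
    refine measure_mono_null (fun x hx => ?_) hnull
    by_contra hpx
    exact hx (hpe x hpx)
  have hmp : MeasurePreserving e (μ.comap e) μ := ⟨he.measurable, hmap⟩
  have hfin : IsFiniteMeasure (μ.comap e) := by
    refine ⟨?_⟩
    rw [← Set.preimage_univ (f := e), hmp.measure_preimage MeasurableSet.univ.nullMeasurableSet]
    exact measure_lt_top _ _
  let c : Lp ℂ 2 μ →ₗᵢ[ℂ] Lp ℂ 2 (μ.comap e) := Lp.compMeasurePreservingₗᵢ ℂ e hmp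
  have hc : ∀ g, c g =ᵐ[μ.comap e] g ∘ e := fun g => Lp.coeFn_compMeasurePreserving g hmp
  have hsurj : Function.Surjective c := by
    intro g
    obtain ⟨k, hk, hke⟩ := he.exists_stronglyMeasurable_extend (Lp.stronglyMeasurable g)
      (fun _ => ⟨0⟩)
    have hkm : MemLp k 2 μ := by
      rw [← hmap, he.memLp_map_measure_iff, hke]
      exact Lp.memLp g
    refine ⟨hkm.toLp k, ?_⟩
    apply Lp.ext
    filter_upwards [hc (hkm.toLp k), hmp.quasiMeasurePreserving.ae hkm.coeFn_toLp] with y h1 h2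
    rw [h1, Function.comp, h2, ← hke]
    rfl
  let E := LinearIsometryEquiv.ofSurjective c hsurj
  have hE : ∀ g, E g = c g := fun _ => rfl
  have hEs : ∀ g, J.comp E.symm.toLinearIsometry g = J (E.symm g) := fun _ => rfl
  refine ⟨μ.comap e, hfin, J.comp E.symm.toLinearIsometry, fun f => ?_, fun x hx g => ?_,
    fun f g => ?_⟩
  · exact ⟨E (ContinuousMap.toLp (E := ℂ) 2 μ ℂ f), by rw [hEs, E.symm_apply_apply, hJ]⟩
  · rw [hEs]
    refine hd.induction_on (p := fun k => ⟪J k, x⟫_ℂ = 0) (E.symm g)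
      (isClosed_eq (by fun_prop) continuous_const) fun f => ?_
    rw [hJ]
    exact hx f
  · refine ⟨E (mulL2 μ f (E.symm g)), by rw [hEs, hEs, E.symm_apply_apply, hmul], ?_⟩
    have h3 := hc (E.symm g)
    rw [← hE, E.apply_symm_apply] at h3
    filter_upwards [hc (mulL2 μ f (E.symm g)), h3,
      hmp.quasiMeasurePreserving.ae (coeFn_mulL2 μ f (E.symm g))] with y h1 h2 h4
    rw [hE, h1, h2]
    exact h4

/-- A function that vanishes on the zeros of `q` kills every vector that `ρ(q)` kills. -/
theorem apply_eq_zero_of_zeros_subset (ρ : C(X, ℂ) →⋆ₐ[ℂ] (H →L[ℂ] H)) {q f : C(X, ℂ)}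
    (hqf : ∀ x, q x = 0 → f x = 0) {x : H} (hx : ρ q x = 0) : ρ f x = 0 := by
  obtain ⟨μ, hμ, J, -, hJ, -⟩ := exists_cyclic_isometry ρ x
  have hq : ContinuousMap.toLp (E := ℂ) 2 μ ℂ q = 0 := by
    rw [← norm_eq_zero, ← J.norm_map, hJ, hx, norm_zero]
  have hf : ContinuousMap.toLp (E := ℂ) 2 μ ℂ f = 0 := by
    apply Lp.ext
    have h := ContinuousMap.coeFn_toLp (p := 2) (𝕜 := ℂ) μ q
    rw [hq] at h
    filter_upwards [h, ContinuousMap.coeFn_toLp (p := 2) (𝕜 := ℂ) μ f, Lp.coeFn_zero ℂ 2 μ]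
      with y h1 h2 h3
    rw [h2, h3]
    rw [h3] at h1
    exact hqf y h1.symm
  rw [← hJ, hf, map_zero]

end Restrict

/-! ### Assembling an orthogonal decomposition -/

section Assemble

section Sum

variable {H : Type*} [NormedAddCommGroup H] [InnerProductSpace ℂ H]

/-- The sum of two isometries with orthogonal ranges, on the Hilbert space direct sum. -/
def LinearIsometry.coprodL2 {A B : Type*} [NormedAddCommGroup A] [InnerProductSpace ℂ A]
    [NormedAddCommGroup B] [InnerProductSpace ℂ B] (α : A →ₗᵢ[ℂ] H) (β : B →ₗᵢ[ℂ] H)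
    (h : ∀ a b, ⟪α a, β b⟫_ℂ = 0) : WithLp 2 (A × B) →ₗᵢ[ℂ] H where
  toFun x := α x.fst + β x.snd
  map_add' x y := by
    simp only [WithLp.add_fst, WithLp.add_snd, map_add]
    abel
  map_smul' c x := by simp
  norm_map' x := by
    refine (pow_left_inj₀ (norm_nonneg _) (norm_nonneg _) two_ne_zero).1 ?_
    rw [WithLp.prod_norm_sq_eq_of_L2, pow_two]
    refine (norm_add_sq_eq_norm_sq_add_norm_sq_of_inner_eq_zero (𝕜 := ℂ) _ _ (h _ _)).trans ?_
    rw [α.norm_map, β.norm_map, pow_two, pow_two]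

theorem LinearIsometry.coprodL2_apply {A B : Type*} [NormedAddCommGroup A] [InnerProductSpace ℂ A]
    [NormedAddCommGroup B] [InnerProductSpace ℂ B] (α : A →ₗᵢ[ℂ] H) (β : B →ₗᵢ[ℂ] H)
    (h : ∀ a b, ⟪α a, β b⟫_ℂ = 0) (x : WithLp 2 (A × B)) :
    α.coprodL2 β h x = α x.fst + β x.snd := rfl

theorem inner_toLp_left {A B : Type*} [NormedAddCommGroup A] [InnerProductSpace ℂ A]
    [NormedAddCommGroup B] [InnerProductSpace ℂ B] (a : A) (y : WithLp 2 (A × B)) :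
    ⟪WithLp.toLp 2 (a, (0 : B)), y⟫_ℂ = ⟪a, y.fst⟫_ℂ := by
  rw [WithLp.prod_inner_apply]; simp

theorem inner_toLp_right {A B : Type*} [NormedAddCommGroup A] [InnerProductSpace ℂ A]
    [NormedAddCommGroup B] [InnerProductSpace ℂ B] (b : B) (y : WithLp 2 (A × B)) :
    ⟪WithLp.toLp 2 ((0 : A), b), y⟫_ℂ = ⟪b, y.snd⟫_ℂ := by
  rw [WithLp.prod_inner_apply]; simp

/-- A vector orthogonal to all ranges is orthogonal to their Hilbert sum. -/
theorem OrthogonalFamily.inner_linearIsometry_eq_zero [CompleteSpace H] {ι : Type*}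
    {G : ι → Type*} [∀ i, NormedAddCommGroup (G i)] [∀ i, InnerProductSpace ℂ (G i)]
    {V : ∀ i, G i →ₗᵢ[ℂ] H} (hV : OrthogonalFamily ℂ G V) {x : H}
    (hx : ∀ i g, ⟪x, V i g⟫_ℂ = 0) (f : lp G 2) : ⟪x, hV.linearIsometry f⟫_ℂ = 0 := by
  have h := (hV.hasSum_linearIsometry f).mapL (innerSL ℂ x)
  simp only [innerSL_apply_apply, hx] at h
  exact h.unique hasSum_zero

end Sum

/-- The data of an orthogonal decomposition of `H` into two closed subspaces and the ranges of two
families of isometries that are defined on `L²` spaces. -/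
structure HalmosData (H : Type u) [NormedAddCommGroup H] [InnerProductSpace ℂ H] where
  Kneg : Submodule ℂ H
  Kpos : Submodule ℂ H
  isClosed_Kneg : IsClosed (Kneg : Set H)
  isClosed_Kpos : IsClosed (Kpos : Set H)
  ι : Type u
  μpos : ι → Measure UpperArc
  μneg : ι → Measure LowerArc
  finite_pos : ∀ i, IsFiniteMeasure (μpos i)
  finite_neg : ∀ i, IsFiniteMeasure (μneg i)
  μpos_eq : ∀ i, μpos i = (μneg i).map LowerArc.conj
  Jpos : ∀ i, Lp ℂ 2 (μpos i) →ₗᵢ[ℂ] H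
  Jneg : ∀ i, Lp ℂ 2 (μneg i) →ₗᵢ[ℂ] H
  inner_K : ∀ x ∈ Kneg, ∀ y ∈ Kpos, ⟪x, y⟫_ℂ = 0
  inner_Kneg_pos : ∀ x ∈ Kneg, ∀ i g, ⟪x, Jpos i g⟫_ℂ = 0
  inner_Kpos_pos : ∀ x ∈ Kpos, ∀ i g, ⟪x, Jpos i g⟫_ℂ = 0
  inner_Kneg_neg : ∀ x ∈ Kneg, ∀ i g, ⟪x, Jneg i g⟫_ℂ = 0
  inner_Kpos_neg : ∀ x ∈ Kpos, ∀ i g, ⟪x, Jneg i g⟫_ℂ = 0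
  orthogonal_pos : OrthogonalFamily ℂ (fun i => Lp ℂ 2 (μpos i)) Jpos
  orthogonal_neg : OrthogonalFamily ℂ (fun i => Lp ℂ 2 (μneg i)) Jneg
  inner_pos_neg : ∀ i j f g, ⟪Jpos i f, Jneg j g⟫_ℂ = 0
  total : ∀ x, (∀ y ∈ Kneg, ⟪y, x⟫_ℂ = 0) → (∀ y ∈ Kpos, ⟪y, x⟫_ℂ = 0) →
    (∀ i g, ⟪Jpos i g, x⟫_ℂ = 0) → (∀ i g, ⟪Jneg i g, x⟫_ℂ = 0) → x = 0

namespace HalmosData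

variable {H : Type u} [NormedAddCommGroup H] [InnerProductSpace ℂ H] [CompleteSpace H]

/-- The isometry from the model space onto `H`. -/
def toIsometry (d : HalmosData H) :
    WithLp 2 (WithLp 2 (d.Kneg × d.Kpos) × WithLp 2 (L2Sum d.μpos × L2Sum d.μneg)) →ₗᵢ[ℂ] H :=
  (d.Kneg.subtypeₗᵢ.coprodL2 d.Kpos.subtypeₗᵢ fun a b => d.inner_K a a.2 b b.2).coprodL2
    (d.orthogonal_pos.linearIsometry.coprodL2 d.orthogonal_neg.linearIsometry fun f g =>
      d.orthogonal_neg.inner_linearIsometry_eq_zero (fun j g => inner_eq_zero_symm.1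
        (d.orthogonal_pos.inner_linearIsometry_eq_zero
          (fun i f => inner_eq_zero_symm.1 (d.inner_pos_neg i j f g)) f)) g)
    fun a b => by
      simp only [LinearIsometry.coprodL2_apply, inner_add_right]
      change ⟪(a.fst : H) + (a.snd : H), _⟫_ℂ + ⟪(a.fst : H) + (a.snd : H), _⟫_ℂ = 0
      rw [inner_add_left, inner_add_left,
        d.orthogonal_pos.inner_linearIsometry_eq_zero (d.inner_Kneg_pos _ a.fst.2),
        d.orthogonal_pos.inner_linearIsometry_eq_zero (d.inner_Kpos_pos _ a.snd.2),
        d.orthogonal_neg.inner_linearIsometry_eq_zero (d.inner_Kneg_neg _ a.fst.2),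
        d.orthogonal_neg.inner_linearIsometry_eq_zero (d.inner_Kpos_neg _ a.snd.2)]
      simp

theorem toIsometry_apply (d : HalmosData H) (y) : d.toIsometry y =
    ((y.fst.fst : H) + (y.fst.snd : H)) +
      (d.orthogonal_pos.linearIsometry y.snd.fst + d.orthogonal_neg.linearIsometry y.snd.snd) :=
  rfl

open scoped Classical in
theorem toIsometry_pos (d : HalmosData H) (i) (g : Lp ℂ 2 (d.μpos i)) :
    d.toIsometry (WithLp.toLp 2 (0, WithLp.toLp 2 (lp.single 2 i g, 0))) = d.Jpos i g := by
  rw [toIsometry_apply]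
  simp [OrthogonalFamily.linearIsometry_apply_single]

open scoped Classical in
theorem toIsometry_neg (d : HalmosData H) (i) (g : Lp ℂ 2 (d.μneg i)) :
    d.toIsometry (WithLp.toLp 2 (0, WithLp.toLp 2 (0, lp.single 2 i g))) = d.Jneg i g := by
  rw [toIsometry_apply]
  simp [OrthogonalFamily.linearIsometry_apply_single]

theorem toIsometry_Kneg (d : HalmosData H) (x : d.Kneg) :
    d.toIsometry (WithLp.toLp 2 (WithLp.toLp 2 (x, 0), 0)) = x := by
  rw [toIsometry_apply]; simp

theorem toIsometry_Kpos (d : HalmosData H) (x : d.Kpos) :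
    d.toIsometry (WithLp.toLp 2 (WithLp.toLp 2 (0, x), 0)) = x := by
  rw [toIsometry_apply]; simp

theorem toIsometry_surjective (d : HalmosData H) : Function.Surjective d.toIsometry := by
  have := d.isClosed_Kneg.completeSpace_coe
  have := d.isClosed_Kpos.completeSpace_coe
  have hcl : IsClosed (LinearMap.range d.toIsometry.toLinearMap : Set H) :=
    d.toIsometry.isometry.isClosedEmbedding.isClosed_range
  have := hcl.completeSpace_coe
  refine LinearMap.range_eq_top.1 (Submodule.orthogonal_eq_bot_iff.1 ?_)
  rw [Submodule.eq_bot_iff]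
  intro x hx
  have hx' : ∀ y, ⟪d.toIsometry y, x⟫_ℂ = 0 := fun y =>
    (Submodule.mem_orthogonal _ _).1 hx _ ⟨y, rfl⟩
  refine d.total x (fun y hy => ?_) (fun y hy => ?_) (fun i g => ?_) fun i g => ?_
  · simpa only [d.toIsometry_Kneg ⟨y, hy⟩] using
      hx' (WithLp.toLp 2 (WithLp.toLp 2 (⟨y, hy⟩, 0), 0))
  · simpa only [d.toIsometry_Kpos ⟨y, hy⟩] using
      hx' (WithLp.toLp 2 (WithLp.toLp 2 (0, ⟨y, hy⟩), 0))
  · rw [← d.toIsometry_pos]; exact hx' _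
  · rw [← d.toIsometry_neg]; exact hx' _

/-- The unitary from the model space onto `H`. -/
def toEquiv (d : HalmosData H) :
    WithLp 2 (WithLp 2 (d.Kneg × d.Kpos) × WithLp 2 (L2Sum d.μpos × L2Sum d.μneg)) ≃ₗᵢ[ℂ] H :=
  LinearIsometryEquiv.ofSurjective d.toIsometry d.toIsometry_surjective

theorem inner_Jpos (d : HalmosData H) (x : H) (i : d.ι) (g : Lp ℂ 2 (d.μpos i)) :
    ⟪d.Jpos i g, x⟫_ℂ = ⟪g, (d.toEquiv.symm x).snd.fst i⟫_ℂ := by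
  classical
  obtain ⟨y, rfl⟩ := d.toEquiv.surjective x
  rw [d.toEquiv.symm_apply_apply, ← d.toIsometry_pos]
  refine (d.toIsometry.inner_map_map _ y).trans ?_
  refine (inner_toLp_right _ y).trans ((inner_toLp_left _ y.snd).trans ?_)
  exact lp.inner_single_left (G := fun i => Lp ℂ 2 (d.μpos i)) i g _

theorem inner_Jneg (d : HalmosData H) (x : H) (i : d.ι) (g : Lp ℂ 2 (d.μneg i)) :
    ⟪d.Jneg i g, x⟫_ℂ = ⟪g, (d.toEquiv.symm x).snd.snd i⟫_ℂ := by
  classical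
  obtain ⟨y, rfl⟩ := d.toEquiv.surjective x
  rw [d.toEquiv.symm_apply_apply, ← d.toIsometry_neg]
  refine (d.toIsometry.inner_map_map _ y).trans ?_
  refine (inner_toLp_right _ y).trans ((inner_toLp_right _ y.snd).trans ?_)
  exact lp.inner_single_left (G := fun i => Lp ℂ 2 (d.μneg i)) i g _

/-- A component in `L²(S₊, μ₊)` is determined by the inner products with the range of the
corresponding isometry. -/
theorem pos_eq (d : HalmosData H) (x : H) (i : d.ι) (y : Lp ℂ 2 (d.μpos i))
    (h : ∀ g, ⟪d.Jpos i g, x⟫_ℂ = ⟪g, y⟫_ℂ) : (d.toEquiv.symm x).snd.fst i = y :=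
  ext_inner_left ℂ fun g => (d.inner_Jpos x i g).symm.trans (h g)

theorem neg_eq (d : HalmosData H) (x : H) (i : d.ι) (y : Lp ℂ 2 (d.μneg i))
    (h : ∀ g, ⟪d.Jneg i g, x⟫_ℂ = ⟪g, y⟫_ℂ) : (d.toEquiv.symm x).snd.snd i = y :=
  ext_inner_left ℂ fun g => (d.inner_Jneg x i g).symm.trans (h g)

/-- The decomposition of `H` given by the data. -/
def toDecomposition (d : HalmosData H) : HalmosDecomposition H where
  Kneg := d.Kneg
  Kpos := d.Kpos
  isClosed_Kneg := d.isClosed_Kneg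
  isClosed_Kpos := d.isClosed_Kpos
  ι := d.ι
  μpos := d.μpos
  μneg := d.μneg
  finite_pos := d.finite_pos
  finite_neg := d.finite_neg
  μpos_eq := d.μpos_eq
  U := d.toEquiv.symm
  U_neg x := by
    rw [LinearIsometryEquiv.symm_apply_eq]
    exact (d.toIsometry_Kneg x).symm
  U_pos x := by
    rw [LinearIsometryEquiv.symm_apply_eq]
    exact (d.toIsometry_Kpos x).symm

end HalmosData

end Assemble

/-! ### The two arcs of the circle -/

section Arcs

/-- The Borel `σ`-algebra of the circle. -/
instance circleMeasurableSpace : MeasurableSpace Circle := borel Circle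

instance circleBorelSpace : BorelSpace Circle := ⟨rfl⟩

/-- The positive part of `Im z`, a continuous function that vanishes exactly off `S₊`. -/
def upperFn : C(Circle, ℂ) := ofRealMap ⟨fun z => max (z : ℂ).im 0, by fun_prop⟩

/-- The negative part of `Im z`, a continuous function that vanishes exactly off `S₋`. -/
def lowerFn : C(Circle, ℂ) := ofRealMap ⟨fun z => max (-(z : ℂ).im) 0, by fun_prop⟩

theorem upperFn_apply (z : Circle) : upperFn z = ((max (z : ℂ).im 0 : ℝ) : ℂ) := rfl

theorem lowerFn_apply (z : Circle) : lowerFn z = ((max (-(z : ℂ).im) 0 : ℝ) : ℂ) := rfl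

theorem circleConj_coe (z : Circle) : ((circleConj z : Circle) : ℂ) = (starRingEnd ℂ) (z : ℂ) :=
  Circle.coe_inv_eq_conj z

theorem star_upperFn : star upperFn = upperFn := by
  ext z
  rw [ContinuousMap.star_apply, upperFn_apply, RCLike.star_def, Complex.conj_ofReal]

theorem star_lowerFn : star lowerFn = lowerFn := by
  ext z
  rw [ContinuousMap.star_apply, lowerFn_apply, RCLike.star_def, Complex.conj_ofReal]

theorem upperFn_mul_lowerFn : upperFn * lowerFn = 0 := by
  ext z
  rw [ContinuousMap.mul_apply, upperFn_apply, lowerFn_apply, ← Complex.ofReal_mul]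
  rcases le_total 0 (z : ℂ).im with h | h
  · rw [max_eq_right (by linarith : -(z : ℂ).im ≤ 0), mul_zero]; rfl
  · rw [max_eq_right h, zero_mul]; rfl

theorem upperFn_comp_circleConj : upperFn.comp circleConj = lowerFn := by
  ext z
  rw [ContinuousMap.comp_apply, upperFn_apply, lowerFn_apply, circleConj_coe, Complex.conj_im]

theorem comp_circleConj_comp_circleConj (f : C(Circle, ℂ)) :
    (f.comp circleConj).comp circleConj = f := by
  ext z
  exact congrArg f (inv_inv z)

theorem circleCoord_apply (z : Circle) : circleCoord z = z := rfl

theorem isInducing_circle_coe : Topology.IsInducing fun z : Circle => (z : ℂ) :=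
  Topology.IsInducing.subtypeVal

theorem measurableEmbedding_toCircle : MeasurableEmbedding UpperArc.toCircle := by
  have hc : Continuous UpperArc.toCircle :=
    isInducing_circle_coe.continuous_iff.2 continuous_subtype_val
  have he : Topology.IsEmbedding UpperArc.toCircle :=
    Topology.IsEmbedding.of_comp hc isInducing_circle_coe.continuous
      (g := fun z : Circle => (z : ℂ)) Topology.IsEmbedding.subtypeVal
  refine he.measurableEmbedding ?_
  have : Set.range UpperArc.toCircle = {z : Circle | 0 < (z : ℂ).im} := by
    ext z
    constructor
    · rintro ⟨w, rfl⟩; exact w.2.2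
    · intro h; exact ⟨⟨z, Circle.norm_coe z, h⟩, rfl⟩
  rw [this]
  exact (isOpen_lt continuous_const (by fun_prop)).measurableSet

theorem mem_range_toCircle_of_upperFn_ne_zero (z : Circle) (h : upperFn z ≠ 0) :
    z ∈ Set.range UpperArc.toCircle := by
  refine ⟨⟨z, Circle.norm_coe z, ?_⟩, rfl⟩
  by_contra hz
  exact h (by rw [upperFn_apply, max_eq_right (not_lt.1 hz), Complex.ofReal_zero])

theorem measurable_upperArc_conj : Measurable UpperArc.conj :=
  (Continuous.subtype_mk (Complex.continuous_conj.comp continuous_subtype_val) _).measurable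

theorem measurable_lowerArc_conj : Measurable LowerArc.conj :=
  (Continuous.subtype_mk (Complex.continuous_conj.comp continuous_subtype_val) _).measurable

theorem UpperArc.conj_conj (z : UpperArc) : z.conj.conj = z := Subtype.ext (Complex.conj_conj _)

theorem LowerArc.conj_conj (z : LowerArc) : z.conj.conj = z := Subtype.ext (Complex.conj_conj _)

theorem LowerArc.toCircle_conj (z : LowerArc) : z.conj.toCircle = circleConj z.toCircle :=
  Circle.ext (circleConj_coe z.toCircle).symm

theorem map_conj_map_conj (μ : Measure UpperArc) :
    (μ.map UpperArc.conj).map LowerArc.conj = μ := by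
  rw [Measure.map_map measurable_lowerArc_conj measurable_upperArc_conj]
  convert Measure.map_id
  exact funext UpperArc.conj_conj

end Arcs

/-! ### Representations of `C(S¹)` and covariant representations -/

section Covariant

variable {H : Type u} [NormedAddCommGroup H] [InnerProductSpace ℂ H] [CompleteSpace H]

/-- The vectors on which `C(S¹)` acts by evaluation at `z`. -/
def charSpace (ρ : C(Circle, ℂ) →⋆ₐ[ℂ] (H →L[ℂ] H)) (z : Circle) : Submodule ℂ H where
  carrier := {x | ∀ f, ρ f x = f z • x}
  add_mem' {x y} hx hy f := by rw [map_add, hx f, hy f, smul_add]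
  zero_mem' f := by simp
  smul_mem' c x hx f := by rw [map_smul, hx f, smul_comm]

theorem isClosed_charSpace (ρ : C(Circle, ℂ) →⋆ₐ[ℂ] (H →L[ℂ] H)) (z : Circle) :
    IsClosed (charSpace ρ z : Set H) := by
  have : (charSpace ρ z : Set H) = ⋂ f, {x | ρ f x = f z • x} := by
    ext x; simp [charSpace]
  rw [this]
  exact isClosed_iInter fun f => isClosed_eq (ρ f).continuous (by fun_prop)

/-- If `ρ(|Im z|)` kills `x`, then the values of a function at `±1` determine its action on `x`. -/
theorem apply_eq_zero_of_upper_lower (ρ : C(Circle, ℂ) →⋆ₐ[ℂ] (H →L[ℂ] H)) {x : H}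
    (hu : ρ upperFn x = 0) (hl : ρ lowerFn x = 0) {f : C(Circle, ℂ)} (h1 : f 1 = 0)
    (h2 : f (-1) = 0) : ρ f x = 0 := by
  refine apply_eq_zero_of_zeros_subset ρ (q := upperFn + lowerFn) (fun z hz => ?_)
    (by rw [map_add, add_apply, hu, hl, add_zero])
  rw [ContinuousMap.add_apply, upperFn_apply, lowerFn_apply, ← Complex.ofReal_add,
    Complex.ofReal_eq_zero] at hz
  have him : (z : ℂ).im = 0 := by
    have h3 := le_max_left (z : ℂ).im 0
    have h4 := le_max_right (z : ℂ).im 0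
    have h5 := le_max_left (-(z : ℂ).im) 0
    have h6 := le_max_right (-(z : ℂ).im) 0
    linarith
  have hn := Circle.normSq_coe z
  rw [Complex.normSq_apply, him, mul_zero, add_zero] at hn
  rcases mul_self_eq_one_iff.1 hn with hre | hre
  · rw [show z = 1 from Circle.ext (Complex.ext hre (by simpa using him))]; exact h1
  · rw [show z = -1 from Circle.ext (Complex.ext (by simpa using hre) (by simpa using him))]
    exact h2

theorem upperFn_charSpace {ρ : C(Circle, ℂ) →⋆ₐ[ℂ] (H →L[ℂ] H)} {z : Circle}
    (hz : (z : ℂ).im = 0) {x : H} (hx : x ∈ charSpace ρ z) : ρ upperFn x = 0 := by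
  rw [hx upperFn, upperFn_apply, hz]; simp

/-- A vector killed by `ρ(|Im z|)` and orthogonal to both eigenspaces vanishes: the eigenvectors
`ρ(z ± 1) x` differ by `2x`. -/
theorem eq_zero_of_orthogonal_charSpace (ρ : C(Circle, ℂ) →⋆ₐ[ℂ] (H →L[ℂ] H)) {x : H}
    (hu : ρ upperFn x = 0) (hl : ρ lowerFn x = 0)
    (h1 : ∀ y ∈ charSpace ρ (-1), ⟪y, x⟫_ℂ = 0) (h2 : ∀ y ∈ charSpace ρ 1, ⟪y, x⟫_ℂ = 0) :
    x = 0 := by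
  have hp : ρ (circleCoord + 1) x ∈ charSpace ρ 1 := by
    intro f
    have h := apply_eq_zero_of_upper_lower ρ hu hl (f := (f - f 1 • 1) * (circleCoord + 1))
      (by simp) (by simp [circleCoord_apply])
    rw [map_mul, map_sub, map_smul, map_one ρ, mul_apply_eq_comp] at h
    exact sub_eq_zero.1 h
  have hm : ρ (circleCoord - 1) x ∈ charSpace ρ (-1) := by
    intro f
    have h := apply_eq_zero_of_upper_lower ρ hu hl (f := (f - f (-1) • 1) * (circleCoord - 1))
      (by simp [circleCoord_apply]) (by simp)
    rw [map_mul, map_sub, map_smul, map_one ρ, mul_apply_eq_comp] at h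
    exact sub_eq_zero.1 h
  have hxx : ρ (circleCoord + 1) x - ρ (circleCoord - 1) x = (2 : ℂ) • x := by
    rw [map_add, map_sub, map_one, add_apply, sub_apply, two_smul, one_apply_eq_self]
    abel
  have h := inner_sub_left (𝕜 := ℂ) (ρ (circleCoord + 1) x) (ρ (circleCoord - 1) x) x
  rw [hxx, h2 _ hp, h1 _ hm, sub_zero, inner_smul_left] at h
  simpa using h

theorem inner_charSpace {ρ : C(Circle, ℂ) →⋆ₐ[ℂ] (H →L[ℂ] H)} {x y : H}
    (hx : x ∈ charSpace ρ (-1)) (hy : y ∈ charSpace ρ 1) : ⟪x, y⟫_ℂ = 0 := by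
  have h := inner_rep_left ρ (circleCoord + star circleCoord) x y
  rw [hx, star_add, star_star, hy, inner_smul_left, inner_smul_right] at h
  simp only [ContinuousMap.add_apply, ContinuousMap.star_apply, circleCoord_apply, Circle.coe_neg,
    Circle.coe_one, star_neg, star_one, map_add, map_neg, map_one] at h
  linear_combination (-1 / 4 : ℂ) * h

/-- The spectral subspace of the open set `{p ≠ 0}`: the closure of the range of `ρ(p)` for a real
function `p`, encoded as the orthogonal complement of the kernel. -/
abbrev suppSpace (ρ : C(Circle, ℂ) →⋆ₐ[ℂ] (H →L[ℂ] H)) (p : C(Circle, ℂ)) : Submodule ℂ H :=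
  (LinearMap.ker (ρ p).toLinearMap)ᗮ

theorem inner_eq_zero_of_mem_suppSpace {ρ : C(Circle, ℂ) →⋆ₐ[ℂ] (H →L[ℂ] H)} {p : C(Circle, ℂ)}
    {x y : H} (hx : ρ p x = 0) (hy : y ∈ suppSpace ρ p) : ⟪x, y⟫_ℂ = 0 :=
  (Submodule.mem_orthogonal _ _).1 hy x hx

theorem apply_mem_suppSpace {ρ : C(Circle, ℂ) →⋆ₐ[ℂ] (H →L[ℂ] H)} {p : C(Circle, ℂ)}
    (hp : star p = p) (x : H) : ρ p x ∈ suppSpace ρ p := by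
  refine (Submodule.mem_orthogonal _ _).2 fun y hy => ?_
  have h := inner_rep_left ρ p y x
  rw [hp] at h
  rw [← h, show ρ p y = 0 from hy, inner_zero_left]

theorem apply_comm (ρ : C(Circle, ℂ) →⋆ₐ[ℂ] (H →L[ℂ] H)) (f g : C(Circle, ℂ)) (x : H) :
    ρ f (ρ g x) = ρ g (ρ f x) := by
  rw [← mul_apply_eq_comp, ← map_mul, mul_comm, map_mul, mul_apply_eq_comp]

/-- `ρ(q)` kills the support space of `p` if `pq = 0`. -/
theorem apply_eq_zero_of_mem_suppSpace {ρ : C(Circle, ℂ) →⋆ₐ[ℂ] (H →L[ℂ] H)}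
    {p q : C(Circle, ℂ)} (hq : star q = q) (hpq : p * q = 0) {y : H} (hy : y ∈ suppSpace ρ p) :
    ρ q y = 0 := by
  have hk : ∀ x, ρ p (ρ q x) = 0 := fun x => by
    rw [← mul_apply_eq_comp, ← map_mul, hpq, map_zero]; rfl
  have h := inner_rep_left ρ q (ρ q y) y
  rw [hq, inner_eq_zero_of_mem_suppSpace (hk _) hy] at h
  exact inner_self_eq_zero.1 h.symm

namespace CovariantRep

theorem V_V (C : CovariantRep H) (x : H) : C.V (C.V x) = x := by
  rw [← mul_apply_eq_comp, C.sq_V]; rfl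

theorem star_V (C : CovariantRep H) : star C.V = C.V := by
  calc star C.V = star C.V * C.V * C.V := by rw [mul_assoc, C.sq_V, mul_one]
    _ = C.V := by rw [Unitary.star_mul_self_of_mem C.unitary_V, one_mul]

theorem inner_V (C : CovariantRep H) (x y : H) : ⟪C.V x, y⟫_ℂ = ⟪x, C.V y⟫_ℂ := by
  conv_lhs => rw [← C.star_V]
  rw [ContinuousLinearMap.star_eq_adjoint, ContinuousLinearMap.adjoint_inner_left]

theorem V_ρ (C : CovariantRep H) (f : C(Circle, ℂ)) (x : H) :
    C.V (C.ρ f x) = C.ρ (f.comp circleConj) (C.V x) := by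
  rw [← C.covariant, C.star_V, mul_apply_eq_comp, mul_apply_eq_comp, V_V]

theorem V_mem_charSpace (C : CovariantRep H) {z : Circle} (hz : z⁻¹ = z) {x : H}
    (hx : x ∈ charSpace C.ρ z) : C.V x ∈ charSpace C.ρ z := by
  intro f
  have h := C.V_ρ (f.comp circleConj) x
  rw [comp_circleConj_comp_circleConj, hx, map_smul] at h
  rw [← h]
  exact congrArg (fun w => f w • C.V x) hz

/-- `V` as an isometry. -/
def isometryV (C : CovariantRep H) : H →ₗᵢ[ℂ] H where
  toLinearMap := C.V.toLinearMap
  norm_map' x := by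
    refine (pow_left_inj₀ (norm_nonneg _) (norm_nonneg _) two_ne_zero).1 ?_
    change ‖C.V x‖ ^ 2 = _
    rw [@norm_sq_eq_re_inner ℂ, @norm_sq_eq_re_inner ℂ, C.inner_V, C.V_V]

end CovariantRep

/-- The support space of `p` is a sum of mutually orthogonal cyclic subspaces, of a single one if
`C(S¹)` acts cyclically on a space that contains it. -/
theorem exists_generating_family (ρ : C(Circle, ℂ) →⋆ₐ[ℂ] (H →L[ℂ] H)) {p : C(Circle, ℂ)}
    (hp : star p = p) (M : Submodule ℂ H) (hM : ∀ x, ρ p x ∈ M) :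
    ∃ (ι : Type u) (v : ι → H), (∀ i, v i ∈ suppSpace ρ p) ∧
      (∀ i j, i ≠ j → ∀ f, ⟪ρ f (v i), v j⟫_ℂ = 0) ∧
      (∀ x, (∀ i f, ⟪ρ f (v i), x⟫_ℂ = 0) → ρ p x = 0) ∧
      ((∃ w : H, closure {y | ∃ f : C(Circle, ℂ), y = ρ f w} = (M : Set H)) →
        Nonempty (Unique ι)) := by
  by_cases hcyc : ∃ w : H, closure {y | ∃ f : C(Circle, ℂ), y = ρ f w} = (M : Set H)
  · obtain ⟨w, hw⟩ := hcyc
    refine ⟨PUnit, fun _ => ρ p w, fun _ => apply_mem_suppSpace hp w,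
      fun i j hij => absurd (Subsingleton.elim i j) hij, fun x hx => ?_, fun _ => ⟨inferInstance⟩⟩
    -- `ρ(p) x` is orthogonal to the orbit of `w`, whose closure contains `ρ(p) x` itself
    have h1 : ∀ y ∈ closure {y | ∃ f : C(Circle, ℂ), y = ρ f w}, ⟪y, ρ p x⟫_ℂ = 0 := by
      intro y hy
      refine closure_minimal (s := {y | ∃ f : C(Circle, ℂ), y = ρ f w})
        (t := {y | ⟪y, ρ p x⟫_ℂ = 0}) ?_ (isClosed_eq (by fun_prop) continuous_const) hy
      rintro _ ⟨f, rfl⟩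
      have h2 := hx PUnit.unit f
      rw [apply_comm, inner_rep_left, hp] at h2
      exact h2
    exact inner_self_eq_zero.1 (h1 (ρ p x) (by rw [hw]; exact hM x))
  · let S : Set (Set H) := {s | (∀ v ∈ s, v ∈ suppSpace ρ p ∧ v ≠ 0) ∧
      s.Pairwise fun v w => ∀ f, ⟪ρ f v, w⟫_ℂ = 0}
    obtain ⟨m, hm⟩ := zorn_subset S (fun c hc hchain => by
      refine ⟨⋃₀ c, ⟨?_, ?_⟩, fun s hs => Set.subset_sUnion_of_mem hs⟩
      · rintro v ⟨s, hs, hv⟩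
        exact (hc hs).1 v hv
      · exact (Set.pairwise_sUnion hchain.directedOn).2 fun s hs => (hc hs).2)
    refine ⟨m, fun i => i, fun i => (hm.1.1 i i.2).1,
      fun i j hij => hm.1.2 i.2 j.2 (fun h => hij (Subtype.ext h)), fun x hx => ?_,
      fun h => absurd h hcyc⟩
    by_contra hne
    have horth : ∀ v ∈ m, ∀ f, ⟪ρ f v, ρ p x⟫_ℂ = 0 := by
      intro v hv f
      have h := inner_rep_left ρ p (ρ f v) x
      rw [hp, ← mul_apply_eq_comp, ← map_mul] at h
      rw [← h]
      exact hx ⟨v, hv⟩ _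
    have hmem : insert (ρ p x) m ∈ S := by
      refine ⟨?_, ?_⟩
      · rintro v (rfl | hv)
        · exact ⟨apply_mem_suppSpace hp x, hne⟩
        · exact hm.1.1 v hv
      · refine hm.1.2.insert fun v hv _ => ⟨fun f => ?_, horth v hv⟩
        rw [inner_rep_left, ← inner_conj_symm, horth v hv, map_zero]
    have hin : ρ p x ∈ m := hm.2 hmem (Set.subset_insert _ _) (Set.mem_insert _ _)
    have h0 := horth _ hin 1
    rw [map_one, one_apply_eq_self] at h0
    exact hne (inner_self_eq_zero.1 h0)

end Covariant

/-! ### The structure theorem -/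

section Structure

variable {H : Type u} [NormedAddCommGroup H] [InnerProductSpace ℂ H] [CompleteSpace H]

/-- Composition with conjugation, as an isometry from `L²` of the lower arc to `L²` of the
upper arc. -/
def conjL2 (μ : Measure UpperArc) : Lp ℂ 2 (μ.map UpperArc.conj) →ₗᵢ[ℂ] Lp ℂ 2 μ :=
  Lp.compMeasurePreservingₗᵢ ℂ UpperArc.conj ⟨measurable_upperArc_conj, rfl⟩

theorem coeFn_conjL2 (μ : Measure UpperArc) (g : Lp ℂ 2 (μ.map UpperArc.conj)) :
    conjL2 μ g =ᵐ[μ] fun z => g z.conj :=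
  Lp.coeFn_compMeasurePreserving g ⟨measurable_upperArc_conj, rfl⟩

theorem measurePreserving_lowerArc_conj (μ : Measure UpperArc) :
    MeasurePreserving LowerArc.conj (μ.map UpperArc.conj) μ :=
  ⟨measurable_lowerArc_conj, map_conj_map_conj μ⟩

/-- `conjL2` is surjective, and its inverse is composition with conjugation as well. -/
theorem exists_conjL2_eq (μ : Measure UpperArc) (g : Lp ℂ 2 μ) :
    ∃ k, conjL2 μ k = g ∧ k =ᵐ[μ.map UpperArc.conj] fun z => g z.conj := by
  have hmn := measurePreserving_lowerArc_conj μ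
  have hk := Lp.coeFn_compMeasurePreserving g hmn
  refine ⟨Lp.compMeasurePreserving LowerArc.conj hmn g, ?_, hk⟩
  apply Lp.ext
  filter_upwards [coeFn_conjL2 μ (Lp.compMeasurePreserving LowerArc.conj hmn g),
    ae_of_ae_map measurable_upperArc_conj.aemeasurable hk] with z h1 h2
  rw [h1, h2, Function.comp, UpperArc.conj_conj]

/-- If multiplication by `f` on `L²` corresponds to `ρ(f)` under an isometry `J`, then it does so
for the components with respect to `J` of arbitrary vectors. -/
theorem inner_rep_of_intertwining {A : Type*} [NormedAddCommGroup A] [InnerProductSpace ℂ A]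
    (ρ : C(Circle, ℂ) →⋆ₐ[ℂ] (H →L[ℂ] H)) (J : A →ₗᵢ[ℂ] H)
    (hJ : ∀ (f : C(Circle, ℂ)) (g : A), ∃ g' : A, J g' = ρ f (J g)) {x : H} {y y' : A}
    (hy : ∀ g, ⟪J g, x⟫_ℂ = ⟪g, y⟫_ℂ) {f : C(Circle, ℂ)} (hy' : J y' = ρ f (J y)) (g : A) :
    ⟪J g, ρ f x⟫_ℂ = ⟪g, y'⟫_ℂ := by
  obtain ⟨k, hk⟩ := hJ (star f) g
  have h1 := inner_rep_left ρ (star f) (J g) x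
  have h2 := inner_rep_left ρ (star f) (J g) (J y)
  rw [star_star] at h1 h2
  rw [← h1, ← hk, hy, ← J.inner_map_map, hk, h2, ← hy', J.inner_map_map]

/-- The structure theorem for covariant representations.  The support space of the positive part of
`Im z` is a sum of cyclic subspaces, each of which is an `L²` space over the upper arc; `V` carries
it onto the support space of the negative part. -/
theorem CovariantRep.exists_halmosDecomposition (C : CovariantRep H) :
    ∃ D : HalmosDecomposition H,
      (∀ f : C(Circle, ℂ),
        (∀ x ∈ D.Kneg, C.ρ f x = f (-1) • x) ∧
        (∀ x ∈ D.Kpos, C.ρ f x = f 1 • x) ∧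
        (∀ (x : H) (i : D.ι),
          D.pos (C.ρ f x) i =ᵐ[D.μpos i] fun z => f z.toCircle * D.pos x i z) ∧
        (∀ (x : H) (i : D.ι),
          D.neg (C.ρ f x) i =ᵐ[D.μneg i] fun z => f z.toCircle * D.neg x i z)) ∧
      (∀ x ∈ D.Kneg, C.V x ∈ D.Kneg) ∧
      (∀ x ∈ D.Kpos, C.V x ∈ D.Kpos) ∧
      (∀ (x : H) (i : D.ι), D.pos (C.V x) i =ᵐ[D.μpos i] fun z => D.neg x i z.conj) ∧
      (∀ (x : H) (i : D.ι), D.neg (C.V x) i =ᵐ[D.μneg i] fun z => D.pos x i z.conj) ∧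
      ((∃ v : H, closure {y | ∃ f : C(Circle, ℂ), y = C.ρ f v} = (D.Kᗮ : Set H)) →
        Nonempty (Unique D.ι)) := by
  have him1 : ((-1 : Circle) : ℂ).im = 0 := by simp
  have him2 : ((1 : Circle) : ℂ).im = 0 := by simp
  have hinv : (-1 : Circle)⁻¹ = -1 := by simp
  obtain ⟨ι, v, hv, hvo, hvt, hvu⟩ := exists_generating_family C.ρ star_upperFn
    (charSpace C.ρ (-1) ⊔ charSpace C.ρ 1)ᗮ (fun x => by
      refine (Submodule.mem_orthogonal _ _).2 fun y hy => ?_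
      obtain ⟨a, ha, b, hb, rfl⟩ := Submodule.mem_sup.1 hy
      refine inner_eq_zero_of_mem_suppSpace ?_ (apply_mem_suppSpace star_upperFn x)
      rw [map_add, upperFn_charSpace him1 ha, upperFn_charSpace him2 hb, add_zero])
  choose μ hμ J hJv hJo hJm using fun i => exists_isometry_of_mem_ker_orthogonal
    measurableEmbedding_toCircle C.ρ mem_range_toCircle_of_upperFn_ne_zero (hv i)
  have hJs : ∀ i g, J i g ∈ suppSpace C.ρ upperFn := by
    intro i g
    refine (Submodule.mem_orthogonal _ _).2 fun x hx =>
      inner_eq_zero_symm.1 (hJo i x (fun f => ?_) g)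
    rw [inner_rep_left]
    refine inner_eq_zero_symm.1 (inner_eq_zero_of_mem_suppSpace ?_ (hv i))
    rw [apply_comm, show C.ρ upperFn x = 0 from hx, map_zero]
  have hJorth : OrthogonalFamily ℂ (fun i => Lp ℂ 2 (μ i)) J := by
    intro i j hij g g'
    refine hJo i _ (fun f => inner_eq_zero_symm.1 (hJo j _ (fun f' => ?_) g')) g
    have h := inner_rep_left C.ρ (star f) (C.ρ f' (v j)) (v i)
    rw [star_star, ← mul_apply_eq_comp, ← map_mul, hvo j i hij.symm] at h
    exact h.symm
  have hKJ : ∀ {z : Circle}, (z : ℂ).im = 0 → ∀ x ∈ charSpace C.ρ z, ∀ i g, ⟪x, J i g⟫_ℂ = 0 :=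
    fun hz x hx i g => inner_eq_zero_of_mem_suppSpace (upperFn_charSpace hz hx) (hJs i g)
  -- `V` transports the cyclic subspaces over the upper arc to the lower arc
  let Jn : ∀ i, Lp ℂ 2 ((μ i).map UpperArc.conj) →ₗᵢ[ℂ] H := fun i =>
    C.isometryV.comp ((J i).comp (conjL2 (μ i)))
  have hJn : ∀ i g, Jn i g = C.V (J i (conjL2 (μ i) g)) := fun _ _ => rfl
  let d : HalmosData H :=
    { Kneg := charSpace C.ρ (-1)
      Kpos := charSpace C.ρ 1
      isClosed_Kneg := isClosed_charSpace _ _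
      isClosed_Kpos := isClosed_charSpace _ _
      ι := ι
      μpos := μ
      μneg := fun i => (μ i).map UpperArc.conj
      finite_pos := hμ
      finite_neg := fun i => inferInstance
      μpos_eq := fun i => (map_conj_map_conj _).symm
      Jpos := J
      Jneg := Jn
      inner_K := fun x hx y hy => inner_charSpace hx hy
      inner_Kneg_pos := hKJ him1
      inner_Kpos_pos := hKJ him2
      inner_Kneg_neg := fun x hx i g => by
        rw [hJn, ← C.inner_V]
        exact hKJ him1 _ (C.V_mem_charSpace hinv hx) _ _
      inner_Kpos_neg := fun x hx i g => by
        rw [hJn, ← C.inner_V]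
        exact hKJ him2 _ (C.V_mem_charSpace inv_one hx) _ _
      orthogonal_pos := hJorth
      orthogonal_neg := fun i j hij g g' => by
        change ⟪Jn i g, Jn j g'⟫_ℂ = 0
        rw [hJn, hJn, C.inner_V, C.V_V]
        exact hJorth hij _ _
      inner_pos_neg := fun i j f g => by
        rw [hJn]
        refine inner_eq_zero_symm.1 (inner_eq_zero_of_mem_suppSpace ?_ (hJs i f))
        have h := C.V_ρ lowerFn (J j (conjL2 (μ j) g))
        rw [apply_eq_zero_of_mem_suppSpace star_lowerFn upperFn_mul_lowerFn (hJs j _), map_zero,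
          ← upperFn_comp_circleConj, comp_circleConj_comp_circleConj] at h
        exact h.symm
      total := fun x h1 h2 h3 h4 => by
        have hker : ∀ y, (∀ i g, ⟪J i g, y⟫_ℂ = 0) → C.ρ upperFn y = 0 := by
          refine fun y hy => hvt y fun i f => ?_
          obtain ⟨g, hg⟩ := hJv i f
          rw [← hg]
          exact hy i g
        refine eq_zero_of_orthogonal_charSpace C.ρ (hker x h3) ?_ h1 h2
        have h5 := hker (C.V x) fun i g => by
          obtain ⟨k, hk, -⟩ := exists_conjL2_eq (μ i) g
          rw [← hk, ← C.inner_V, ← hJn]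
          exact h4 i k
        have h6 := C.V_ρ lowerFn x
        rw [← upperFn_comp_circleConj, comp_circleConj_comp_circleConj, h5] at h6
        rw [← C.V_V (C.ρ lowerFn x), ← upperFn_comp_circleConj, h6, map_zero] }
  -- multiplication operators on the lower arc
  have hJnm : ∀ i (f : C(Circle, ℂ)) g, ∃ g', Jn i g' = C.ρ f (Jn i g) ∧
      g' =ᵐ[(μ i).map UpperArc.conj] fun z => f z.toCircle * g z := by
    intro i f g
    obtain ⟨k, hk, hkae⟩ := hJm i (f.comp circleConj) (conjL2 (μ i) g)
    obtain ⟨g', hg', hgae⟩ := exists_conjL2_eq (μ i) k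
    refine ⟨g', ?_, ?_⟩
    · rw [hJn, hJn, hg', hk, C.V_ρ, comp_circleConj_comp_circleConj]
    · have hq := (measurePreserving_lowerArc_conj (μ i)).quasiMeasurePreserving
      filter_upwards [hgae, hq.ae hkae, hq.ae (coeFn_conjL2 (μ i) g)] with z h1 h2 h3
      rw [h1, h2, h3, LowerArc.conj_conj, LowerArc.toCircle_conj, ContinuousMap.comp_apply]
      exact congrArg (fun w => f w * g z) (inv_inv z.toCircle)
  have hpos : ∀ (x : H) (i : ι) (g : Lp ℂ 2 (μ i)),
      ⟪J i g, x⟫_ℂ = ⟪g, (d.toEquiv.symm x).snd.fst i⟫_ℂ := d.inner_Jpos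
  have hneg : ∀ (x : H) (i : ι) (g : Lp ℂ 2 ((μ i).map UpperArc.conj)),
      ⟪Jn i g, x⟫_ℂ = ⟪g, (d.toEquiv.symm x).snd.snd i⟫_ℂ := d.inner_Jneg
  have hVpos : ∀ (x : H) (i : ι) (g : Lp ℂ 2 (μ i)),
      ⟪J i g, C.V x⟫_ℂ = ⟪g, conjL2 (μ i) ((d.toEquiv.symm x).snd.snd i)⟫_ℂ := by
    intro x i g
    obtain ⟨k, hk, -⟩ := exists_conjL2_eq (μ i) g
    rw [← hk, ← C.inner_V, ← hJn, hneg]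
    exact ((conjL2 (μ i)).inner_map_map _ _).symm
  have hVneg : ∀ (x : H) (i : ι) (k g : Lp ℂ 2 ((μ i).map UpperArc.conj)),
      conjL2 (μ i) k = (d.toEquiv.symm x).snd.fst i → ⟪Jn i g, C.V x⟫_ℂ = ⟪g, k⟫_ℂ := by
    intro x i k g hk
    rw [hJn, C.inner_V, C.V_V, hpos, ← hk]
    exact (conjL2 (μ i)).inner_map_map _ _
  refine ⟨d.toDecomposition, fun f => ⟨fun x hx => hx f, fun x hx => hx f, fun x i => ?_,
    fun x i => ?_⟩, fun x hx => C.V_mem_charSpace hinv hx,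
    fun x hx => C.V_mem_charSpace inv_one hx, fun x i => ?_, fun x i => ?_, fun h => hvu h⟩
  · obtain ⟨g', hg', hae⟩ := hJm i f ((d.toEquiv.symm x).snd.fst i)
    have h := d.pos_eq (C.ρ f x) i g' (inner_rep_of_intertwining C.ρ (J i)
      (fun f g => (hJm i f g).imp fun _ h => h.1) (hpos x i) hg')
    change ⇑((d.toEquiv.symm (C.ρ f x)).snd.fst i) =ᵐ[μ i] _
    rw [h]
    exact hae
  · obtain ⟨g', hg', hae⟩ := hJnm i f ((d.toEquiv.symm x).snd.snd i)
    have h := d.neg_eq (C.ρ f x) i g' (inner_rep_of_intertwining C.ρ (Jn i)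
      (fun f g => (hJnm i f g).imp fun _ h => h.1) (hneg x i) hg')
    change ⇑((d.toEquiv.symm (C.ρ f x)).snd.snd i) =ᵐ[(μ i).map UpperArc.conj] _
    rw [h]
    exact hae
  · have h := d.pos_eq (C.V x) i _ (hVpos x i)
    change ⇑((d.toEquiv.symm (C.V x)).snd.fst i) =ᵐ[μ i] _
    rw [h]
    exact coeFn_conjL2 (μ i) _
  · obtain ⟨k, hk, hkae⟩ := exists_conjL2_eq (μ i) ((d.toEquiv.symm x).snd.fst i)
    have h := d.neg_eq (C.V x) i k fun g => hVneg x i k g hk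
    change ⇑((d.toEquiv.symm (C.V x)).snd.snd i) =ᵐ[(μ i).map UpperArc.conj] _
    rw [h]
    exact hkae

end Structure

/-! ### Pairs of projections and covariant representations -/

section Correspondence

variable {H : Type u} [NormedAddCommGroup H] [InnerProductSpace ℂ H]

theorem two_mul_half (V : H →L[ℂ] H) : 2 * ((1 / 2 : ℂ) • (1 + V)) - 1 = V := by
  rw [mul_smul_comm, two_mul, ← two_smul ℂ (1 + V), smul_smul]
  norm_num

theorem half_two_mul (P : H →L[ℂ] H) : (1 / 2 : ℂ) • (1 + (2 * P - 1)) = P := by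
  rw [add_sub_cancel, two_mul, ← two_smul ℂ P, smul_smul]
  norm_num

variable [CompleteSpace H]

/-- A representation of `C(S¹)` is determined by the image of the coordinate function. -/
theorem circleRep_ext {ρ σ : C(Circle, ℂ) →⋆ₐ[ℂ] (H →L[ℂ] H)}
    (h : ρ circleCoord = σ circleCoord) : ρ = σ := by
  have hcont : ∀ φ : C(Circle, ℂ) →⋆ₐ[ℂ] (H →L[ℂ] H), Continuous φ := fun φ =>
    AddMonoidHomClass.continuous_of_bound φ 1
      (by simpa only [one_mul] using! NonUnitalStarAlgHom.nnnorm_apply_le φ)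
  have hsep : (StarAlgHom.equalizer ρ σ).SeparatesPoints := by
    intro z w hzw
    exact ⟨circleCoord, ⟨circleCoord, h, rfl⟩, fun hc => hzw (Circle.ext hc)⟩
  have htop := ContinuousMap.starSubalgebra_topologicalClosure_eq_top_of_separatesPoints _ hsep
  have hcl : IsClosed (StarAlgHom.equalizer ρ σ : Set C(Circle, ℂ)) :=
    isClosed_eq (hcont ρ) (hcont σ)
  ext1 f
  have hf : f ∈ ((StarAlgHom.equalizer ρ σ).topologicalClosure : Set C(Circle, ℂ)) := by
    rw [htop]; trivial
  rw [StarSubalgebra.topologicalClosure_coe, hcl.closure_eq] at hf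
  exact hf

/-- A unitary operator is the image of the coordinate function under a representation of `C(S¹)`,
by the continuous functional calculus. -/
theorem exists_circleRep {U : H →L[ℂ] H} (hU : U ∈ unitary (H →L[ℂ] H)) :
    ∃ ρ : C(Circle, ℂ) →⋆ₐ[ℂ] (H →L[ℂ] H), ρ circleCoord = U := by
  have hn : IsStarNormal U :=
    ⟨by rw [commute_iff_eq, Unitary.star_mul_self_of_mem hU, Unitary.mul_star_self_of_mem hU]⟩
  let ι : C(spectrum ℂ U, Circle) :=
    ⟨fun z => ⟨z, spectrum.subset_circle_of_unitary hU z.2⟩, by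
      exact isInducing_circle_coe.continuous_iff.2 continuous_subtype_val⟩
  refine ⟨(cfcHom (R := ℂ) hn).comp (ContinuousMap.compStarAlgHom' ℂ ℂ ι), ?_⟩
  refine Eq.trans ?_ (cfcHom_id (R := ℂ) hn)
  rfl

theorem CovariantRep.ext_of_coord {C D : CovariantRep H} (hV : C.V = D.V)
    (hρ : C.ρ circleCoord = D.ρ circleCoord) : C = D := by
  have h := circleRep_ext hρ
  cases C
  cases D
  simp only at hV h
  subst hV
  subst h
  rfl

/-- The reflection `2P - 1` of a projection is a symmetry. -/
theorem IsStarProjection.symmetry {P : H →L[ℂ] H} (hP : IsStarProjection P) :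
    star (2 * P - 1) = 2 * P - 1 ∧ (2 * P - 1) * (2 * P - 1) = 1 := by
  have h1 : P * P = P := hP.isIdempotentElem
  have h2 : star P = P := hP.isSelfAdjoint
  constructor
  · rw [two_mul, star_sub, star_add, h2, star_one]
  · simp only [two_mul, sub_mul, mul_sub, add_mul, mul_add, one_mul, mul_one, h1]
    abel

/-- A symmetry `V` is the reflection of the projection `(1 + V) / 2`. -/
theorem isStarProjection_half {V : H →L[ℂ] H} (hs : star V = V) (hV : V * V = 1) :
    IsStarProjection ((1 / 2 : ℂ) • (1 + V)) := by
  constructor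
  · change _ * _ = _
    rw [smul_mul_smul_comm, mul_add, add_mul, add_mul, hV, one_mul, mul_one, one_mul,
      add_comm V 1, ← two_smul ℂ (1 + V), smul_smul]
    norm_num
  · change star _ = _
    rw [star_smul, star_add, star_one, hs]
    norm_num

/-- Two projections define a covariant representation: for the symmetries `V = 2P - 1` and
`W = 2Q - 1`, the coordinate function acts as the unitary `VW`, and `V (VW) V* = (VW)*`. -/
theorem exists_covariantRep {P Q : H →L[ℂ] H} (hP : IsStarProjection P)
    (hQ : IsStarProjection Q) :
    ∃ C : CovariantRep H, C.V = 2 * P - 1 ∧ C.V * C.ρ circleCoord = 2 * Q - 1 := by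
  obtain ⟨hVs, hVV⟩ := hP.symmetry
  obtain ⟨hWs, hWW⟩ := hQ.symmetry
  set V := 2 * P - 1
  set W := 2 * Q - 1
  have hVu : V ∈ unitary (H →L[ℂ] H) := by
    rw [Unitary.mem_iff, hVs]; exact ⟨hVV, hVV⟩
  have hWu : W ∈ unitary (H →L[ℂ] H) := by
    rw [Unitary.mem_iff, hWs]; exact ⟨hWW, hWW⟩
  obtain ⟨ρ, hρ⟩ := exists_circleRep (mul_mem hVu hWu)
  let cj : C(Circle, ℂ) →⋆ₐ[ℂ] C(Circle, ℂ) := ContinuousMap.compStarAlgHom' ℂ ℂ circleConj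
  -- `f ↦ V ρ(f) V*` and `f ↦ ρ(f ∘ c)` are representations that agree at the coordinate function
  let ad : C(Circle, ℂ) →⋆ₐ[ℂ] (H →L[ℂ] H) :=
    { toFun := fun f => V * ρ f * V
      map_one' := by rw [map_one, mul_one, hVV]
      map_mul' := fun f g => by
        calc V * ρ (f * g) * V = V * ρ f * 1 * ρ g * V := by simp only [map_mul, mul_one, mul_assoc]
          _ = V * ρ f * V * (V * ρ g * V) := by rw [← hVV]; simp only [mul_assoc]
      map_zero' := by rw [map_zero, mul_zero, zero_mul]
      map_add' := fun f g => by rw [map_add, mul_add, add_mul]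
      commutes' := fun c => by
        rw [AlgHomClass.commutes, ← Algebra.commutes, mul_assoc, hVV, mul_one]
      map_star' := fun f => by rw [map_star, star_mul, star_mul, hVs, mul_assoc] }
  have hcoord : cj circleCoord = star circleCoord := by
    ext z
    exact circleConj_coe z
  have had : ad = ρ.comp cj := by
    apply circleRep_ext
    change V * ρ circleCoord * V = ρ (cj circleCoord)
    rw [hcoord, map_star, hρ, star_mul, hVs, hWs, ← mul_assoc, hVV, one_mul]
  refine ⟨⟨ρ, V, hVu, hVV, fun f => ?_⟩, rfl, ?_⟩
  · rw [hVs]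
    exact DFunLike.congr_fun had f
  · change V * ρ circleCoord = W
    rw [hρ, ← mul_assoc, hVV, one_mul]

theorem CovariantRep.symmetry_V_coord (C : CovariantRep H) :
    star (C.V * C.ρ circleCoord) = C.V * C.ρ circleCoord ∧
      C.V * C.ρ circleCoord * (C.V * C.ρ circleCoord) = 1 := by
  have hcoord : circleCoord.comp circleConj = star circleCoord := by
    ext z
    exact circleConj_coe z
  have h := C.covariant circleCoord
  rw [C.star_V, hcoord] at h
  constructor
  · rw [star_mul, C.star_V, ← map_star, ← h, mul_assoc, C.sq_V, mul_one]
  · rw [← mul_assoc, h, ← map_mul]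
    have : star circleCoord * circleCoord = 1 := by
      ext z
      rw [ContinuousMap.mul_apply, ContinuousMap.star_apply, RCLike.star_def, circleCoord_apply,
        ← Complex.normSq_eq_conj_mul_self, Circle.normSq_coe]
      simp
    rw [this, map_one]

/-- Representations of `𝒜₂` correspond to covariant representations. -/
theorem exists_equiv_covariantRep :
    ∃ e : (UnivProjAlg.{u} 2 →⋆ₐ[ℂ] (H →L[ℂ] H)) ≃ CovariantRep H,
      ∀ π : UnivProjAlg.{u} 2 →⋆ₐ[ℂ] (H →L[ℂ] H),
        (e π).V = 2 * π (univProj 2 0) - 1 ∧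
        (e π).V * (e π).ρ circleCoord = 2 * π (univProj 2 1) - 1 := by
  choose F hF1 hF2 using fun π : UnivProjAlg.{u} 2 →⋆ₐ[ℂ] (H →L[ℂ] H) =>
    exists_covariantRep ((isStarProjection_univProj.{u} 2 0).map π)
      ((isStarProjection_univProj.{u} 2 1).map π)
  have hcan : ∀ {V X Y : H →L[ℂ] H}, V * V = 1 → V * X = V * Y → X = Y := by
    intro V X Y hV h
    rw [← one_mul X, ← hV, mul_assoc, h, ← mul_assoc, hV, one_mul]
  refine ⟨Equiv.ofBijective F ⟨fun π σ h => ?_, fun C => ?_⟩, fun π => ⟨hF1 π, hF2 π⟩⟩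
  · have h0 : π (univProj 2 0) = σ (univProj 2 0) := by
      rw [← half_two_mul (π _), ← half_two_mul (σ _), ← hF1, ← hF1, h]
    have h1 : π (univProj 2 1) = σ (univProj 2 1) := by
      rw [← half_two_mul (π _), ← half_two_mul (σ _), ← hF2, ← hF2, h]
    refine (existsUnique_univProjAlg_hom (fun j => σ (univProj 2 j))
      fun j => (isStarProjection_univProj.{u} 2 j).map σ).unique ?_ fun j => rfl
    exact Fin.forall_fin_two.2 ⟨h0, h1⟩
  · obtain ⟨hs, hsq⟩ := C.symmetry_V_coord
    obtain ⟨π, hπ, -⟩ := existsUnique_univProjAlg_hom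
      ![(1 / 2 : ℂ) • (1 + C.V), (1 / 2 : ℂ) • (1 + C.V * C.ρ circleCoord)]
      (Fin.forall_fin_two.2 ⟨isStarProjection_half C.star_V C.sq_V, isStarProjection_half hs hsq⟩)
    have h0 : π (univProj 2 0) = (1 / 2 : ℂ) • (1 + C.V) := hπ 0
    have h1 : π (univProj 2 1) = (1 / 2 : ℂ) • (1 + C.V * C.ρ circleCoord) := hπ 1
    have hV : (F π).V = C.V := by rw [hF1, h0, two_mul_half]
    refine ⟨π, CovariantRep.ext_of_coord hV (hcan C.sq_V ?_)⟩
    have h := hF2 π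
    rw [h1, two_mul_half, hV] at h
    exact h

end Correspondence

/-! ### The projections in the decomposition -/

section Components

variable {H : Type u} [NormedAddCommGroup H] [InnerProductSpace ℂ H]

namespace HalmosDecomposition

theorem quasiMeasurePreserving_upper (D : HalmosDecomposition H) (i : D.ι) :
    Measure.QuasiMeasurePreserving UpperArc.conj (D.μpos i) (D.μneg i) := by
  refine ⟨measurable_upperArc_conj, ?_⟩
  rw [D.μpos_eq, Measure.map_map measurable_upperArc_conj measurable_lowerArc_conj,
    show UpperArc.conj ∘ LowerArc.conj = id from funext LowerArc.conj_conj, Measure.map_id]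

theorem quasiMeasurePreserving_lower (D : HalmosDecomposition H) (i : D.ι) :
    Measure.QuasiMeasurePreserving LowerArc.conj (D.μneg i) (D.μpos i) :=
  ⟨measurable_lowerArc_conj, by rw [D.μpos_eq]⟩

theorem pos_add (D : HalmosDecomposition H) (x y : H) (i : D.ι) :
    D.pos (x + y) i =ᵐ[D.μpos i] fun z => D.pos x i z + D.pos y i z := by
  unfold pos
  rw [map_add]
  exact Lp.coeFn_add _ _

theorem neg_add (D : HalmosDecomposition H) (x y : H) (i : D.ι) :
    D.neg (x + y) i =ᵐ[D.μneg i] fun z => D.neg x i z + D.neg y i z := by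
  unfold neg
  rw [map_add]
  exact Lp.coeFn_add _ _

theorem pos_smul (D : HalmosDecomposition H) (c : ℂ) (x : H) (i : D.ι) :
    D.pos (c • x) i =ᵐ[D.μpos i] fun z => c * D.pos x i z := by
  unfold pos
  rw [map_smul]
  exact Lp.coeFn_smul _ _

theorem neg_smul (D : HalmosDecomposition H) (c : ℂ) (x : H) (i : D.ι) :
    D.neg (c • x) i =ᵐ[D.μneg i] fun z => c * D.neg x i z := by
  unfold neg
  rw [map_smul]
  exact Lp.coeFn_smul _ _

theorem pos_half_add (D : HalmosDecomposition H) (x y : H) (i : D.ι) :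
    D.pos ((1 / 2 : ℂ) • (x + y)) i =ᵐ[D.μpos i]
      fun z => (1 / 2 : ℂ) * (D.pos x i z + D.pos y i z) := by
  filter_upwards [D.pos_smul (1 / 2) (x + y) i, D.pos_add x y i] with z h1 h2
  rw [h1, h2]

theorem neg_half_add (D : HalmosDecomposition H) (x y : H) (i : D.ι) :
    D.neg ((1 / 2 : ℂ) • (x + y)) i =ᵐ[D.μneg i]
      fun z => (1 / 2 : ℂ) * (D.neg x i z + D.neg y i z) := by
  filter_upwards [D.neg_smul (1 / 2) (x + y) i, D.neg_add x y i] with z h1 h2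
  rw [h1, h2]

theorem inner_Kneg (D : HalmosDecomposition H) (a : D.Kneg) (y : H) :
    ⟪(a : H), y⟫_ℂ = ⟪a, (D.U y).fst.fst⟫_ℂ := by
  rw [← D.U.inner_map_map, D.U_neg]
  exact (inner_toLp_left _ _).trans (inner_toLp_left _ _)

theorem inner_Kpos (D : HalmosDecomposition H) (a : D.Kpos) (y : H) :
    ⟪(a : H), y⟫_ℂ = ⟪a, (D.U y).fst.snd⟫_ℂ := by
  rw [← D.U.inner_map_map, D.U_pos]
  exact (inner_toLp_left _ _).trans (inner_toLp_right _ _)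

theorem inner_K_eq_zero (D : HalmosDecomposition H) {x y : H} (hx : x ∈ D.K)
    (hy : (D.U y).fst = 0) : ⟪x, y⟫_ℂ = 0 := by
  obtain ⟨a, ha, b, hb, rfl⟩ := Submodule.mem_sup.1 hx
  rw [inner_add_left, D.inner_Kneg ⟨a, ha⟩, D.inner_Kpos ⟨b, hb⟩, hy, WithLp.zero_fst,
    WithLp.zero_snd, inner_zero_right, inner_zero_right, add_zero]

theorem fst_eq_zero (D : HalmosDecomposition H) {y : H} (hy : ∀ x ∈ D.K, ⟪x, y⟫_ℂ = 0) :
    (D.U y).fst = 0 := by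
  have h1 : (D.U y).fst.fst = 0 := inner_self_eq_zero.1 ((D.inner_Kneg _ y).symm.trans
    (hy _ (Submodule.mem_sup_left (D.U y).fst.fst.2)))
  have h2 : (D.U y).fst.snd = 0 := inner_self_eq_zero.1 ((D.inner_Kpos _ y).symm.trans
    (hy _ (Submodule.mem_sup_right (D.U y).fst.snd.2)))
  exact congrArg (WithLp.toLp 2) (Prod.ext h1 h2)

/-- A vector orthogonal to `K` without components on the upper arc lies in `L²(S₋, μ₋)`. -/
theorem exists_eq_ofNeg (D : HalmosDecomposition H) {y : H} (hy : (D.U y).fst = 0)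
    (hpos : ∀ i, D.pos y i =ᵐ[D.μpos i] 0) : ∃ g, y = D.ofNeg g := by
  refine ⟨(D.U y).snd.snd, ?_⟩
  rw [ofNeg, LinearIsometryEquiv.eq_symm_apply]
  have h : (D.U y).snd.fst = 0 := lp.ext (funext fun i => Lp.ext ((hpos i).trans
    (Lp.coeFn_zero _ _ _).symm))
  exact congrArg (WithLp.toLp 2) (Prod.ext hy (congrArg (WithLp.toLp 2) (Prod.ext h rfl)))

theorem exists_eq_ofPos (D : HalmosDecomposition H) {y : H} (hy : (D.U y).fst = 0)
    (hneg : ∀ i, D.neg y i =ᵐ[D.μneg i] 0) : ∃ f, y = D.ofPos f := by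
  refine ⟨(D.U y).snd.fst, ?_⟩
  rw [ofPos, LinearIsometryEquiv.eq_symm_apply]
  have h : (D.U y).snd.snd = 0 := lp.ext (funext fun i => Lp.ext ((hneg i).trans
    (Lp.coeFn_zero _ _ _).symm))
  exact congrArg (WithLp.toLp 2) (Prod.ext hy (congrArg (WithLp.toLp 2) (Prod.ext rfl h)))

theorem U_ofPos (D : HalmosDecomposition H) (f : L2Sum D.μpos) :
    D.U (D.ofPos f) = WithLp.toLp 2 (0, WithLp.toLp 2 (f, 0)) := D.U.apply_symm_apply _

theorem U_ofNeg (D : HalmosDecomposition H) (g : L2Sum D.μneg) :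
    D.U (D.ofNeg g) = WithLp.toLp 2 (0, WithLp.toLp 2 (0, g)) := D.U.apply_symm_apply _

theorem neg_ofPos (D : HalmosDecomposition H) (f : L2Sum D.μpos) (i : D.ι) :
    D.neg (D.ofPos f) i =ᵐ[D.μneg i] 0 := by
  unfold neg
  rw [U_ofPos]
  exact Lp.coeFn_zero _ _ _

theorem pos_ofNeg (D : HalmosDecomposition H) (g : L2Sum D.μneg) (i : D.ι) :
    D.pos (D.ofNeg g) i =ᵐ[D.μpos i] 0 := by
  unfold pos
  rw [U_ofNeg]
  exact Lp.coeFn_zero _ _ _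

end HalmosDecomposition

end Components

end

theorem mainTheorem2 {H : Type u} [NormedAddCommGroup H] [InnerProductSpace ℂ H]
    [CompleteSpace H] :
    -- representations of `𝒜₂` on `H` are the same as covariant representations on `H`
    ∃ e : (UnivProjAlg.{u} 2 →⋆ₐ[ℂ] (H →L[ℂ] H)) ≃ CovariantRep H,
      (∀ π : UnivProjAlg.{u} 2 →⋆ₐ[ℂ] (H →L[ℂ] H),
        (e π).V = 2 * π (univProj 2 0) - 1 ∧
        (e π).V * (e π).ρ circleCoord = 2 * π (univProj 2 1) - 1) ∧
      ∀ π : UnivProjAlg.{u} 2 →⋆ₐ[ℂ] (H →L[ℂ] H),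
        -- the structure theorem
        (∃ D : HalmosDecomposition H,
          -- `C(S¹)` acts by `f(±1)` on `K_±` and by multiplication on `L²(S_±, μ_±)`
          (∀ f : C(Circle, ℂ),
            (∀ x ∈ D.Kneg, (e π).ρ f x = f (-1) • x) ∧
            (∀ x ∈ D.Kpos, (e π).ρ f x = f 1 • x) ∧
            (∀ (x : H) (i : D.ι),
              D.pos ((e π).ρ f x) i =ᵐ[D.μpos i] fun z => f z.toCircle * D.pos x i z) ∧
            (∀ (x : H) (i : D.ι),
              D.neg ((e π).ρ f x) i =ᵐ[D.μneg i] fun z => f z.toCircle * D.neg x i z)) ∧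
          -- `V` respects `K_±` and switches `L²(S_±, μ_±)`
          (∀ x ∈ D.Kneg, (e π).V x ∈ D.Kneg) ∧
          (∀ x ∈ D.Kpos, (e π).V x ∈ D.Kpos) ∧
          (∀ (x : H) (i : D.ι),
            D.pos ((e π).V x) i =ᵐ[D.μpos i] fun z => D.neg x i z.conj) ∧
          (∀ (x : H) (i : D.ι),
            D.neg ((e π).V x) i =ᵐ[D.μneg i] fun z => D.pos x i z.conj) ∧
          -- both projections respect `K₋ ⊕ K₊` and commute there
          (∀ x ∈ D.K, π (univProj 2 0) x ∈ D.K ∧ π (univProj 2 1) x ∈ D.K ∧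
            π (univProj 2 0) (π (univProj 2 1) x) = π (univProj 2 1) (π (univProj 2 0) x)) ∧
          -- the matrices of the two projections on `L²(S₊, μ₊) ⊕ L²(S₋, μ₋)`
          (∀ (x : H) (i : D.ι),
            (D.pos (π (univProj 2 0) x) i =ᵐ[D.μpos i]
              fun z => (1 / 2 : ℂ) * (D.pos x i z + D.neg x i z.conj)) ∧
            (D.neg (π (univProj 2 0) x) i =ᵐ[D.μneg i]
              fun z => (1 / 2 : ℂ) * (D.pos x i z.conj + D.neg x i z)) ∧
            (D.pos (π (univProj 2 1) x) i =ᵐ[D.μpos i]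
              fun z => (1 / 2 : ℂ) * (D.pos x i z + (z.conj : ℂ) * D.neg x i z.conj)) ∧
            (D.neg (π (univProj 2 1) x) i =ᵐ[D.μneg i]
              fun z => (1 / 2 : ℂ) * ((z.conj : ℂ) * D.pos x i z.conj + D.neg x i z))) ∧
          -- the difference is off-diagonal on the `L²` part
          (∀ f : L2Sum D.μpos, ∃ g : L2Sum D.μneg,
            (π (univProj 2 0) - π (univProj 2 1)) (D.ofPos f) = D.ofNeg g) ∧
          (∀ g : L2Sum D.μneg, ∃ f : L2Sum D.μpos,
            (π (univProj 2 0) - π (univProj 2 1)) (D.ofNeg g) = D.ofPos f) ∧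
          -- the difference is diagonal with eigenvalues among `1, -1, 0` on `K₋ ⊕ K₊`
          (∀ x ∈ D.K, ∃ x₁ ∈ D.K, ∃ x₂ ∈ D.K, ∃ x₃ ∈ D.K, x = x₁ + x₂ + x₃ ∧
            (π (univProj 2 0) - π (univProj 2 1)) x₁ = x₁ ∧
            (π (univProj 2 0) - π (univProj 2 1)) x₂ = -x₂ ∧
            (π (univProj 2 0) - π (univProj 2 1)) x₃ = 0) ∧
          -- if `C(S¹)` acts cyclically on `(K₋ ⊕ K₊)ᗮ`, a single pair of measures suffices
          ((∃ v : H, closure {y | ∃ f : C(Circle, ℂ), y = (e π).ρ f v} = (D.Kᗮ : Set H)) →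
            Nonempty (Unique D.ι))) ∧
        -- the consequence for traces
        (∀ k : ℕ, IsTraceClass ((π (univProj 2 0) - π (univProj 2 1)) ^ (2 * k + 1)) →
          ∃ t : ℂ, ∀ m : ℕ,
            HasTrace ((π (univProj 2 0) - π (univProj 2 1)) ^ (2 * k + 1 + 2 * m)) t) := by
  obtain ⟨e, he⟩ := exists_equiv_covariantRep (H := H)
  refine ⟨e, he, fun π => ⟨?_, fun k hk => hasTrace_sub_pow_of_isTraceClass
    ((isStarProjection_univProj.{u} 2 0).map π) ((isStarProjection_univProj.{u} 2 1).map π) k hk⟩⟩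
  obtain ⟨hV, hVz⟩ := he π
  obtain ⟨D, hρ, hVn, hVp, hVpos, hVneg, hcyc⟩ := (e π).exists_halmosDecomposition
  have hsaA : IsSelfAdjoint (π (univProj 2 0) - π (univProj 2 1)) :=
    ((isStarProjection_univProj.{u} 2 0).map π).isSelfAdjoint.sub
      ((isStarProjection_univProj.{u} 2 1).map π).isSelfAdjoint
  have hP : ∀ x, π (univProj 2 0) x = (1 / 2 : ℂ) • (x + (e π).V x) := fun x => by
    rw [← half_two_mul (π (univProj 2 0)), ← hV]; rfl
  have hQ : ∀ x, π (univProj 2 1) x = (1 / 2 : ℂ) • (x + (e π).V ((e π).ρ circleCoord x)) :=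
    fun x => by rw [← half_two_mul (π (univProj 2 1)), ← hVz]; rfl
  set C := e π
  set P := π (univProj 2 0)
  set Q := π (univProj 2 1)
  set z := C.ρ circleCoord with hz
  have hzn : ∀ x ∈ D.Kneg, z x = -x := fun x hx => by
    rw [hz, (hρ _).1 x hx, circleCoord_apply]; simp
  have hzp : ∀ x ∈ D.Kpos, z x = x := fun x hx => by
    rw [hz, (hρ _).2.1 x hx, circleCoord_apply]; simp
  have hVK : ∀ x ∈ D.K, C.V x ∈ D.K := by
    intro x hx
    obtain ⟨a, ha, b, hb, rfl⟩ := Submodule.mem_sup.1 hx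
    rw [map_add]
    exact Submodule.add_mem_sup (hVn a ha) (hVp b hb)
  have hzK : ∀ x ∈ D.K, z x ∈ D.K := by
    intro x hx
    obtain ⟨a, ha, b, hb, rfl⟩ := Submodule.mem_sup.1 hx
    rw [map_add, hzn a ha, hzp b hb]
    exact Submodule.add_mem_sup (neg_mem ha) hb
  have hVzK : ∀ x ∈ D.K, z (C.V x) = C.V (z x) := by
    intro x hx
    obtain ⟨a, ha, b, hb, rfl⟩ := Submodule.mem_sup.1 hx
    simp only [map_add, hzn a ha, hzp b hb, hzn _ (hVn a ha), hzp _ (hVp b hb), map_neg]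
  have hPK : ∀ x ∈ D.K, P x ∈ D.K := fun x hx => by
    rw [hP]; exact D.K.smul_mem _ (D.K.add_mem hx (hVK x hx))
  have hQK : ∀ x ∈ D.K, Q x ∈ D.K := fun x hx => by
    rw [hQ]; exact D.K.smul_mem _ (D.K.add_mem hx (hVK _ (hzK x hx)))
  have hmat : ∀ (x : H) (i : D.ι),
      (D.pos (P x) i =ᵐ[D.μpos i] fun z => (1 / 2 : ℂ) * (D.pos x i z + D.neg x i z.conj)) ∧
      (D.neg (P x) i =ᵐ[D.μneg i] fun z => (1 / 2 : ℂ) * (D.pos x i z.conj + D.neg x i z)) ∧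
      (D.pos (Q x) i =ᵐ[D.μpos i]
        fun z => (1 / 2 : ℂ) * (D.pos x i z + (z.conj : ℂ) * D.neg x i z.conj)) ∧
      (D.neg (Q x) i =ᵐ[D.μneg i]
        fun z => (1 / 2 : ℂ) * ((z.conj : ℂ) * D.pos x i z.conj + D.neg x i z)) := by
    intro x i
    refine ⟨?_, ?_, ?_, ?_⟩
    · rw [hP]
      filter_upwards [D.pos_half_add x (C.V x) i, hVpos x i] with w h1 h2
      rw [h1, h2]
    · rw [hP]
      filter_upwards [D.neg_half_add x (C.V x) i, hVneg x i] with w h1 h2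
      rw [h1, h2, add_comm]
    · rw [hQ]
      filter_upwards [D.pos_half_add x (C.V (z x)) i, hVpos (z x) i,
        (D.quasiMeasurePreserving_upper i).ae ((hρ circleCoord).2.2.2 x i)] with w h1 h2 h3
      rw [h1, h2, h3]
      rfl
    · rw [hQ]
      filter_upwards [D.neg_half_add x (C.V (z x)) i, hVneg (z x) i,
        (D.quasiMeasurePreserving_lower i).ae ((hρ circleCoord).2.2.1 x i)] with w h1 h2 h3
      rw [h1, h2, h3, add_comm]
      rfl
  have hsub : ∀ x, (P - Q) x = P x + (-1 : ℂ) • Q x := fun x => by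
    rw [sub_apply, neg_one_smul, sub_eq_add_neg]
  -- `P - Q` is self-adjoint and leaves `K` invariant, so it leaves `Kᗮ` invariant as well
  have hfst : ∀ x, (D.U x).fst = 0 → (D.U ((P - Q) x)).fst = 0 := by
    intro x hx
    refine D.fst_eq_zero fun y hy => ?_
    rw [← ContinuousLinearMap.adjoint_inner_left, ← ContinuousLinearMap.star_eq_adjoint,
      hsaA.star_eq]
    exact D.inner_K_eq_zero (D.K.sub_mem (hPK y hy) (hQK y hy)) hx
  have hA : ∀ x, (P - Q) x = (1 / 2 : ℂ) • (C.V x - C.V (z x)) := fun x => by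
    rw [sub_apply, hP, hQ, ← smul_sub, add_sub_add_left_eq_sub]
  refine ⟨D, hρ, hVn, hVp, hVpos, hVneg, fun x hx => ⟨hPK x hx, hQK x hx, ?_⟩, hmat,
    fun f => ?_, fun g => ?_, fun x hx => ?_, hcyc⟩
  · rw [hP (Q x), hQ (P x), hQ x, hP x]
    simp only [map_add, map_smul, hVzK x hx, C.V_V]
    module
  · refine D.exists_eq_ofNeg (hfst _ (by rw [D.U_ofPos]; rfl)) fun i => ?_
    rw [hsub]
    filter_upwards [D.pos_add (P (D.ofPos f)) ((-1 : ℂ) • Q (D.ofPos f)) i,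
      D.pos_smul (-1) (Q (D.ofPos f)) i, (hmat (D.ofPos f) i).1, (hmat (D.ofPos f) i).2.2.1,
      (D.quasiMeasurePreserving_upper i).ae (D.neg_ofPos f i)] with w h1 h2 h3 h4 h5
    rw [h1, h2, h3, h4, h5]
    simp
  · refine D.exists_eq_ofPos (hfst _ (by rw [D.U_ofNeg]; rfl)) fun i => ?_
    rw [hsub]
    filter_upwards [D.neg_add (P (D.ofNeg g)) ((-1 : ℂ) • Q (D.ofNeg g)) i,
      D.neg_smul (-1) (Q (D.ofNeg g)) i, (hmat (D.ofNeg g) i).2.1, (hmat (D.ofNeg g) i).2.2.2,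
      (D.quasiMeasurePreserving_lower i).ae (D.pos_ofNeg g i)] with w h1 h2 h3 h4 h5
    rw [h1, h2, h3, h4, h5]
    simp
  · -- `P - Q` is `0` on `K₊` and the symmetry `V` on `K₋`
    obtain ⟨a, ha, b, hb, rfl⟩ := Submodule.mem_sup.1 hx
    have hVa := hVn a ha
    refine ⟨(1 / 2 : ℂ) • (a + C.V a), Submodule.mem_sup_left (D.Kneg.smul_mem _
      (D.Kneg.add_mem ha hVa)), (1 / 2 : ℂ) • (a - C.V a), Submodule.mem_sup_left
      (D.Kneg.smul_mem _ (D.Kneg.sub_mem ha hVa)), b, Submodule.mem_sup_right hb, ?_, ?_, ?_, ?_⟩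
    · module
    · rw [hA]
      simp only [map_add, map_smul, hzn a ha, hzn _ hVa, map_neg, C.V_V]
      module
    · rw [hA]
      simp only [map_sub, map_smul, hzn a ha, hzn _ hVa, map_neg, C.V_V]
      module
    · rw [hA, hzp b hb, sub_self, smul_zero]
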